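/- Let $R>0$. For positive integers $k,d$ let $$\mathcal G_{k,d}=\Big\{\sum_{j=1}^k w_j\delta_{\mu_j}:\ \mu_j\in\mathbb R^d,\ \|\mu_j\|_2\le R,\ w_j\ge 0,\ \sum_{j=1}^k w_j=1\Big\},$$ and for $\Gamma\in\mathcal G_{k,d}$ let $P_\Gamma=\Gamma*N(0,I_d)$ be the corresponding Gaussian location mixture. Let $H(P,Q)=\big(\int(\sqrt p-\sqrt q)^2\,d\nu\big)^{1/2}$ be the Hellinger distance, where $p,q$ are the densities of $P,Q$ with respect to a common dominating measure $\nu$. For $\Gamma_0\in\mathcal G_{k,d}$ and $\epsilon>0$ put $$\mathcal P_\epsilon(\Gamma_0)=\{P_\Gamma:\ \Gamma\in\mathcal G_{k,d},\ H(P_\Gamma,P_{\Gamma_0})\le\epsilon\}.$$ For $\delta>0$ let $N(\delta,\mathcal P_\epsilon(\Gamma_0),H)$ be the minimum cardinality of a set $C\subseteq\mathcal P_\epsilon(\Gamma_0)$ such that every $P\in\mathcal P_\epsilon(\Gamma_0)$ satisfies $H(P,Q)<\delta$ for some $Q\in C$. Then there is a constant $c>0$ depending only on $R$ such that for all $k,d\ge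 1$, all $\Gamma_0\in\mathcal G_{k,d}$ and all $0<\delta\le\epsilon/2$, $$N(\delta,\mathcal P_\epsilon(\Gamma_0),H)\ \le\ \Big(\frac{\epsilon}{\delta}\Big)^{c\,(dk^4+(2k)^{2k+2})}.$$ -/

import Mathlib

open MeasureTheory ProbabilityTheory
open scoped NNReal ENNReal

noncomputable section

namespace GaussianMixture

/-- The class `𝒢_{k,d}` of `k`-atomic distributions `∑ j, w j • δ_{μ j}` on `ℝ^d` whose atoms lie
in the closed Euclidean ball of radius `R` about the origin. Atoms may coincide and weights may
vanish. -/
def mixingDistributions (R : ℝ) (k d : ℕ) : Set (Measure (EuclideanSpace ℝ (Fin d))) :=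
  {Γ | ∃ (w : Fin k → ℝ≥0) (μ : Fin k → EuclideanSpace ℝ (Fin d)),
    ∑ j, w j = 1 ∧ (∀ j, ‖μ j‖ ≤ R) ∧ Γ = ∑ j, w j • Measure.dirac (μ j)}

/-- The Gaussian location mixture `P_Γ = Γ * N(0, I_d)`. -/
def mixture {d : ℕ} (Γ : Measure (EuclideanSpace ℝ (Fin d))) :
    Measure (EuclideanSpace ℝ (Fin d)) :=
  Γ.conv (stdGaussian (EuclideanSpace ℝ (Fin d)))

/-- The Hellinger distance `H(P, Q) = (∫ (√p - √q)² dν)^{1/2}` of two finite measures, where `p`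
and `q` are the densities of `P` and `Q` with respect to the dominating measure `ν = P + Q`. -/
def hellinger {Ω : Type*} [MeasurableSpace Ω] (P Q : Measure Ω) : ℝ :=
  √(∫ x, (√(P.rnDeriv (P + Q) x).toReal - √(Q.rnDeriv (P + Q) x).toReal) ^ 2 ∂(P + Q))

/-- The covering number `N(δ, A, ρ)`: the least cardinality of a set `C` of points of `A` such that
every point of `A` is at `ρ`-distance less than `δ` from some point of `C`
(it is `⊤` if there is no finite such `C`). -/
def coveringNumber {X : Type*} (δ : ℝ) (A : Set X) (ρ : X → X → ℝ) : ℕ∞ :=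
  ⨅ (C : Set X) (_ : C ⊆ A) (_ : ∀ a ∈ A, ∃ b ∈ C, ρ a b < δ), C.encard

/-- The Hellinger neighbourhood
`𝒫_ε(Γ₀) = {P_Γ : Γ ∈ 𝒢_{k,d}, H(P_Γ, P_{Γ₀}) ≤ ε}`. -/
def hellingerBall (R : ℝ) (k d : ℕ) (ε : ℝ) (Γ₀ : Measure (EuclideanSpace ℝ (Fin d))) :
    Set (Measure (EuclideanSpace ℝ (Fin d))) :=
  {P | ∃ Γ ∈ mixingDistributions R k d, P = mixture Γ ∧ hellinger (mixture Γ) (mixture Γ₀) ≤ ε}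

end GaussianMixture

end

/-!
Write the difference of two mixing distributions as a signed measure `D` with at most `2k` atoms.
The covering bound rests on a comparison of the Hellinger distance `H` of the two mixtures with the
moments `∫ (L x) ^ l dD(x)`, where `L` runs over the complex-valued functionals with `‖L‖ ≤ 1`.

* *Moments are `O(H)`.* By the Cauchy-Schwarz inequality, the integral of `exp L` against the
  difference of the mixture densities is `O(H)`. This integral is the Laplace transform of `D` at
  `L`, up to a Gaussian factor, and Cauchy's estimates turn its values into moments.
* *`H` is bounded by the moments of order less than `2k`.* Since `D` has at most `2k` atoms, its
  moments satisfy a linear recursion, so those of order less than `2k` control its whole Laplace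
  transform. Jensen's inequality dominates a single Gaussian density `φ` by one of the mixtures,
  hence `H²` is at most a constant times `∫ (p - q)² / φ`. This integral is the quadratic form of
  `D` for the kernel `exp ⟪x, y⟫` (centred at the mean of `φ`), that is, the mean of the squared
  Laplace transform of `D` at a random complex Gaussian functional. The functional may be taken on
  the span of the atoms, which makes the constant independent of the ambient dimension.

Over a Hellinger ball of radius `ε` about a fixed mixture, `D` is then described by coordinates in
a ball of radius `O(ε)`: a contraction `S : ℝ²ᵏ → ℝᵈ` whose range contains the atoms, and the
moments of order less than `2k` of the pullback of `D` to `ℝ²ᵏ`. As all moments of `D` are `O(ε)`,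
so is their variation with `S`, and `S` may be rescaled by `ε`. These coordinates live in dimension
at most `2kd + (2k)²ᵏ`, and comparing volumes in that space gives the covering bound.
-/

noncomputable section

namespace GaussianMixture

/-! ### Covering numbers and finite-dimensional parametrizations -/

section Covering

open Module (finrank)

variable {V : Type*} [NormedAddCommGroup V] [NormedSpace ℝ V] [FiniteDimensional ℝ V]

theorem card_mul_ofReal_pow_le_of_isSeparated {C : Set V} {B : ℝ} {η : ℝ≥0} (hB : 0 ≤ B)
    (hη : 0 < η) (hCB : C ⊆ Metric.closedBall 0 B) (hC : Metric.IsSeparated η C) :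
    (C.encard : ℝ≥0∞) * ENNReal.ofReal ((η / 2 : ℝ) ^ finrank ℝ V) ≤
      ENNReal.ofReal ((B + η / 2) ^ finrank ℝ V) := by
  borelize V
  let μ : Measure V := Measure.addHaar
  have hη' : (0 : ℝ) < η / 2 := by positivity
  have disjoint_balls : Pairwise (Function.onFun Disjoint
      fun x : C => Metric.ball (x : V) (η / 2)) := fun x y hxy => by
    refine Metric.ball_disjoint_ball ?_
    have := hC x.2 y.2 (Subtype.coe_ne_coe.2 hxy)
    simp only [edist_nndist, ENNReal.coe_lt_coe] at this
    rw [add_halves, ← coe_nndist]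
    exact_mod_cast this.le
  have balls_subset : (⋃ x : C, Metric.ball (x : V) (η / 2)) ⊆ Metric.ball 0 (B + η / 2) := by
    refine Set.iUnion_subset fun x => Metric.ball_subset_ball' ?_
    linarith [Metric.mem_closedBall.1 (hCB x.2)]
  have volume_le :=
    (tsum_meas_le_meas_iUnion_of_disjoint μ (fun _ => measurableSet_ball) disjoint_balls).trans
      (measure_mono balls_subset)
  simp only [μ.addHaar_ball_of_pos _ hη', ENNReal.tsum_const, μ.addHaar_ball_of_pos _
    (show 0 < B + η / 2 by positivity), ← mul_assoc] at volume_le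
  exact (ENNReal.mul_le_mul_iff_left (Metric.measure_ball_pos μ 0 one_pos).ne'
    measure_ball_lt_top.ne).1 volume_le

theorem packingNumber_le_of_subset_closedBall {A : Set V} {B : ℝ} {η : ℝ≥0} (hB : 0 ≤ B)
    (hη : 0 < η) (hA : A ⊆ Metric.closedBall 0 B) :
    (Metric.packingNumber η A : ℝ≥0∞) ≤ ENNReal.ofReal ((1 + 2 * B / η) ^ finrank ℝ V) := by
  have hη' : (0 : ℝ) < η / 2 := by positivity
  simp only [Metric.packingNumber, ENat.toENNReal_iSup, iSup_le_iff]
  intro C hCA hC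
  have ratio : 1 + 2 * B / η = (B + η / 2) / (η / 2) := by field_simp; ring
  rw [ratio, div_pow, ENNReal.ofReal_div_of_pos (by positivity),
    ENNReal.le_div_iff_mul_le (.inl (by simpa using pow_pos hη' _)) (.inl ENNReal.ofReal_ne_top)]
  exact card_mul_ofReal_pow_le_of_isSeparated hB hη (hCA.trans hA) hC

theorem coveringNumber_le_coveringNumber_image {X Y : Type*} [PseudoMetricSpace Y] {A : Set X}
    {ρ : X → X → ℝ} {Φ : X → Y} {δ : ℝ} {η : ℝ≥0}
    (h : ∀ a ∈ A, ∀ b ∈ A, dist (Φ a) (Φ b) ≤ η → ρ a b < δ) :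
    coveringNumber δ A ρ ≤ Metric.coveringNumber η (Φ '' A) := by
  by_cases covering_ne_top : Metric.coveringNumber η (Φ '' A) = ⊤
  · simp [covering_ne_top]
  obtain ⟨C, hCA, -, hC, hcard⟩ := Metric.exists_set_encard_eq_coveringNumber covering_ne_top
  obtain ⟨D, hDA, hD⟩ := Set.exists_subset_bijOn (A ∩ Φ ⁻¹' C) Φ
  rw [Set.image_inter_preimage, Set.inter_eq_right.2 hCA] at hD
  rw [← hcard, ← hD.image_eq, hD.injOn.encard_image]
  refine iInf₂_le_of_le D (hDA.trans Set.inter_subset_left) (iInf_le _ fun a ha => ?_)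
  obtain ⟨y, hy, hay⟩ := hC (Set.mem_image_of_mem Φ ha)
  obtain ⟨b, hb, rfl⟩ := hD.surjOn hy
  exact ⟨b, hb, h a ha b (hDA hb).1 (NNReal.coe_le_coe.2 (edist_le_coe.1 hay))⟩

theorem coveringNumber_le_of_le_mul_dist {X : Type*} {A : Set X} {ρ : X → X → ℝ} {Φ : X → V}
    {B c δ : ℝ} (hB : 0 ≤ B) (hc : 0 < c) (hδ : 0 < δ) (hΦ : ∀ a ∈ A, ‖Φ a‖ ≤ B)
    (hρ : ∀ a ∈ A, ∀ b ∈ A, ρ a b ≤ c * dist (Φ a) (Φ b)) :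
    (coveringNumber δ A ρ : ℝ≥0∞) ≤ ENNReal.ofReal ((1 + 4 * c * B / δ) ^ finrank ℝ V) := by
  let η : ℝ≥0 := ⟨δ / (2 * c), by positivity⟩
  have hη : 0 < η := show 0 < δ / (2 * c) by positivity
  have ratio : 1 + 4 * c * B / δ = 1 + 2 * B / η := by
    change _ = 1 + 2 * B / (δ / (2 * c))
    field_simp; ring
  have covering_le : coveringNumber δ A ρ ≤ Metric.coveringNumber η (Φ '' A) :=
    coveringNumber_le_coveringNumber_image fun a ha b hb hab => calc
      ρ a b ≤ c * (δ / (2 * c)) := (hρ a ha b hb).trans (by gcongr; exact hab)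
      _ < δ := by field_simp; linarith
  calc (coveringNumber δ A ρ : ℝ≥0∞) ≤ Metric.packingNumber η (Φ '' A) :=
        ENat.toENNReal_le.2 (covering_le.trans (Metric.coveringNumber_le_packingNumber η _))
    _ ≤ ENNReal.ofReal ((1 + 4 * c * B / δ) ^ finrank ℝ V) := by
        rw [ratio]
        exact packingNumber_le_of_subset_closedBall hB hη
          (by rintro _ ⟨a, ha, rfl⟩; simpa using hΦ a ha)

end Covering

/-! ### Moments and Laplace transforms of finitely supported signed measures -/

section Moments

theorem norm_sum_mul_pow_le {ι : Type*} (s : Finset ι) (a z : ι → ℂ) {M ρ : ℝ} (hM : 0 ≤ M)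
    (hρ : 0 ≤ ρ) (hz : ∀ i ∈ s, ‖z i‖ ≤ ρ) (hmoment : ∀ l < s.card, ‖∑ i ∈ s, a i * z i ^ l‖ ≤ M)
    (l : ℕ) : ‖∑ i ∈ s, a i * z i ^ l‖ ≤ (1 + 2 * ρ) ^ l * M := by
  classical
  induction s using Finset.induction_on generalizing a M l with
  | empty => simp only [Finset.sum_empty, norm_zero]; positivity
  | insert i₀ s hi₀ ih =>
    rw [Finset.card_insert_of_notMem hi₀] at hmoment
    -- The weights `a i * (z i - z i₀)` kill the atom `i₀` and obey a one-step moment recursion.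
    have recursion : ∀ l, ∑ i ∈ s, a i * (z i - z i₀) * z i ^ l =
        ∑ i ∈ insert i₀ s, a i * z i ^ (l + 1) - z i₀ * ∑ i ∈ insert i₀ s, a i * z i ^ l := by
      intro l
      rw [Finset.sum_insert hi₀, Finset.sum_insert hi₀, mul_add, Finset.mul_sum,
        add_sub_add_comm, ← Finset.sum_sub_distrib, pow_succ, mul_left_comm (z i₀),
        mul_comm (z i₀), sub_self, zero_add]
      exact Finset.sum_congr rfl fun i _ => by ring
    have norm_z₀ := hz i₀ (Finset.mem_insert_self _ _)
    have reduced := ih (fun i => a i * (z i - z i₀)) (M := (1 + ρ) * M) (by positivity)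
      (fun i hi => hz i (Finset.mem_insert_of_mem hi)) fun l hl => by
        rw [recursion]
        refine (norm_sub_le _ _).trans ?_
        rw [norm_mul, add_mul, one_mul]
        gcongr
        exacts [hmoment _ (by omega), hmoment _ (by omega)]
    induction l with
    | zero => simpa using hmoment 0 (by omega)
    | succ l hl =>
      calc _ = ‖∑ i ∈ s, a i * (z i - z i₀) * z i ^ l
              + z i₀ * ∑ i ∈ insert i₀ s, a i * z i ^ l‖ := by rw [recursion, sub_add_cancel]
        _ ≤ (1 + 2 * ρ) ^ l * ((1 + ρ) * M) + ρ * ((1 + 2 * ρ) ^ l * M) := by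
            refine (norm_add_le _ _).trans (add_le_add (reduced l) ?_)
            rw [norm_mul]; gcongr
        _ = (1 + 2 * ρ) ^ (l + 1) * M := by ring

theorem norm_sum_mul_exp_le {ι : Type*} (s : Finset ι) (a z : ι → ℂ) {M ρ r : ℝ} (hM : 0 ≤ M)
    (hρ : 0 ≤ ρ) (hr : 0 ≤ r) (hz : ∀ i ∈ s, ‖z i‖ ≤ ρ)
    (hmoment : ∀ l < s.card, ‖∑ i ∈ s, a i * z i ^ l‖ ≤ M) :
    ‖∑ i ∈ s, a i * Complex.exp (r * z i)‖ ≤ M * Real.exp ((1 + 2 * ρ) * r) := by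
  have exp_series : HasSum (fun l : ℕ => ∑ i ∈ s, a i * ((r * z i) ^ l / (l.factorial : ℂ)))
      (∑ i ∈ s, a i * Complex.exp (r * z i)) :=
    hasSum_sum fun i _ => .mul_left _ (by
      rw [Complex.exp_eq_exp_ℂ]; exact NormedSpace.expSeries_div_hasSum_exp _)
  have majorant : HasSum (fun l : ℕ => M * (((1 + 2 * ρ) * r) ^ l / (l.factorial : ℝ)))
      (M * Real.exp ((1 + 2 * ρ) * r)) :=
    .mul_left _ (by rw [Real.exp_eq_exp_ℝ]; exact NormedSpace.expSeries_div_hasSum_exp _)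
  rw [← exp_series.tsum_eq]
  refine tsum_of_norm_bounded majorant fun l => ?_
  calc ‖∑ i ∈ s, a i * ((r * z i) ^ l / (l.factorial : ℂ))‖
      = ‖((r ^ l / l.factorial : ℝ) : ℂ) * ∑ i ∈ s, a i * z i ^ l‖ := by
        rw [Finset.mul_sum]
        congr 1
        refine Finset.sum_congr rfl fun i _ => ?_
        push_cast
        ring
    _ ≤ r ^ l / l.factorial * ((1 + 2 * ρ) ^ l * M) := by
        rw [norm_mul, Complex.norm_real, Real.norm_of_nonneg (by positivity)]
        gcongr
        exact norm_sum_mul_pow_le s a z hM hρ hz hmoment l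
    _ = M * (((1 + 2 * ρ) * r) ^ l / l.factorial) := by rw [mul_pow]; ring

theorem norm_sub_le_of_norm_le_two {W : Type*} [NormedAddCommGroup W] [NormedSpace ℂ W]
    {f : W → ℂ} {B : ℝ} (hf : Differentiable ℂ f) (hB : ∀ w, ‖w‖ ≤ 2 → ‖f w‖ ≤ B) {u v : W}
    (hu : ‖u‖ ≤ 1) (hv : ‖v‖ ≤ 1) : ‖f u - f v‖ ≤ 2 * B * ‖u - v‖ := by
  let _ : NormedSpace ℝ W := NormedSpace.restrictScalars ℝ ℂ W
  have norm_fderiv_le : ∀ w ∈ Metric.closedBall (0 : W) 1, ‖fderiv ℂ f w‖ ≤ 2 * B := by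
    intro w hw
    rw [mem_closedBall_zero_iff] at hw
    have maps_to : Set.MapsTo f (Metric.ball w 1) (Metric.closedBall (f w) (2 * B)) := by
      intro w' hw'
      rw [mem_ball_iff_norm] at hw'
      rw [mem_closedBall_iff_norm]
      have norm_w' : ‖w'‖ ≤ 2 := by linarith [norm_le_norm_sub_add w' w]
      linarith [norm_sub_le (f w') (f w), hB w (by linarith), hB w' norm_w']
    simpa using Complex.norm_fderiv_le_div_of_mapsTo_ball hf.differentiableOn maps_to one_pos
  exact (convex_closedBall (0 : W) 1).norm_image_sub_le_of_norm_fderiv_le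
    (fun w _ => hf w) norm_fderiv_le (by simpa using hv) (by simpa using hu)

variable {E : Type*} [NormedAddCommGroup E] [NormedSpace ℝ E]

/-- The `l`-th power moment `∫ (L x) ^ l dD(x)` of the signed measure `D = ∑ x, D x • δ_x` along
the complex-valued functional `L`. Testing with complex functionals makes moments holomorphic in
`L`. -/
def powerMoment (l : ℕ) (L : E →L[ℝ] ℂ) : (E →₀ ℝ) →ₗ[ℝ] ℂ :=
  Finsupp.linearCombination ℝ fun x => L x ^ l

/-- The Laplace transform `∫ exp (L x) dD(x)` of the signed measure `D = ∑ x, D x • δ_x` at the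
complex-valued functional `L`. -/
def laplace (L : E →L[ℝ] ℂ) : (E →₀ ℝ) →ₗ[ℝ] ℂ :=
  Finsupp.linearCombination ℝ fun x => Complex.exp (L x)

theorem powerMoment_apply (l : ℕ) (L : E →L[ℝ] ℂ) (D : E →₀ ℝ) :
    powerMoment l L D = ∑ x ∈ D.support, (D x : ℂ) * L x ^ l := by
  simp [powerMoment, Finsupp.linearCombination_apply, Finsupp.sum]

theorem laplace_apply (L : E →L[ℝ] ℂ) (D : E →₀ ℝ) :
    laplace L D = ∑ x ∈ D.support, (D x : ℂ) * Complex.exp (L x) := by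
  simp [laplace, Finsupp.linearCombination_apply, Finsupp.sum]

theorem norm_laplace_le_of_norm_powerMoment_le {D : E →₀ ℝ} {R M : ℝ} (hR : 0 ≤ R) (hM : 0 ≤ M)
    (hD : ∀ x ∈ D.support, ‖x‖ ≤ R)
    (hmoment : ∀ l < D.support.card, ∀ L : E →L[ℝ] ℂ, ‖L‖ ≤ 1 → ‖powerMoment l L D‖ ≤ M)
    (L : E →L[ℝ] ℂ) : ‖laplace L D‖ ≤ M * Real.exp ((1 + 2 * R) * ‖L‖) := by
  set L₁ : E →L[ℝ] ℂ := ‖L‖⁻¹ • L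
  have norm_L₁ : ‖L₁‖ ≤ 1 := by
    rw [norm_smul, norm_inv, norm_norm]
    exact inv_mul_le_one
  have L_eq : ∀ x, L x = (‖L‖ : ℂ) * L₁ x := fun x => by
    rcases eq_or_ne ‖L‖ 0 with h | h
    · simp [norm_eq_zero.1 h]
    · simp only [L₁, smul_apply, Complex.real_smul, Complex.ofReal_inv]
      rw [mul_inv_cancel_left₀ (by exact_mod_cast h)]
  simp only [laplace_apply, L_eq]
  refine norm_sum_mul_exp_le _ _ _ hM hR (norm_nonneg L) (fun x hx => ?_) fun l hl => ?_
  · calc ‖L₁ x‖ ≤ ‖L₁‖ * ‖x‖ := L₁.le_opNorm x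
      _ ≤ 1 * R := by gcongr; exact hD x hx
      _ = R := one_mul R
  · rw [← powerMoment_apply]
    exact hmoment l hl L₁ norm_L₁

theorem norm_powerMoment_le_of_norm_laplace_le {D : E →₀ ℝ} {r C : ℝ}
    (hlaplace : ∀ L : E →L[ℝ] ℂ, ‖L‖ ≤ r → ‖laplace L D‖ ≤ C) (l : ℕ) {L : E →L[ℝ] ℂ}
    (hL : ‖L‖ ≤ r) : ‖powerMoment l L D‖ ≤ l.factorial * C := by
  let f : ℂ → ℂ := fun z => ∑ x ∈ D.support, (D x : ℂ) * Complex.exp (L x * z)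
  have f_eq : ∀ z, f z = laplace (z • L) D := fun z => by simp [f, laplace_apply, mul_comm]
  have iteratedDeriv_f : iteratedDeriv l f 0 = powerMoment l L D := by
    rw [iteratedDeriv_fun_sum fun x _ => by fun_prop, powerMoment_apply]
    refine Finset.sum_congr rfl fun x _ => ?_
    rw [iteratedDeriv_const_mul_field, iteratedDeriv_cexp_const_mul]
    simp
  have cauchy := Complex.norm_iteratedDeriv_le_of_forall_mem_sphere_norm_le (c := 0) (R := 1) l
    one_pos (f := f) (C := C) (by fun_prop : Differentiable ℂ f).diffContOnCl fun z hz => by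
      rw [f_eq]
      refine hlaplace _ ?_
      rwa [norm_smul, mem_sphere_zero_iff_norm.1 hz, one_mul]
  simpa [iteratedDeriv_f] using cauchy

theorem norm_powerMoment_sub_powerMoment_le {D : E →₀ ℝ} {l : ℕ} {B : ℝ}
    (hB : ∀ L : E →L[ℝ] ℂ, ‖L‖ ≤ 2 → ‖powerMoment l L D‖ ≤ B) {L L' : E →L[ℝ] ℂ}
    (hL : ‖L‖ ≤ 1) (hL' : ‖L'‖ ≤ 1) :
    ‖powerMoment l L D - powerMoment l L' D‖ ≤ 2 * B * ‖L - L'‖ := by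
  have differentiable_apply : ∀ x : E, Differentiable ℂ fun L : E →L[ℝ] ℂ => L x := fun x =>
    (LinearMap.mkContinuous (⟨⟨fun L => L x, fun _ _ => rfl⟩, fun _ _ => rfl⟩ :
      (E →L[ℝ] ℂ) →ₗ[ℂ] ℂ) ‖x‖ fun L => (L.le_opNorm x).trans_eq (mul_comm _ _)).differentiable
  refine norm_sub_le_of_norm_le_two (f := fun L => powerMoment l L D) ?_ hB hL hL'
  simp only [powerMoment_apply]
  exact .fun_sum fun x _ => ((differentiable_apply x).pow l).const_mul _

end Moments

/-! ### Exponential integrals against the standard Gaussian measure -/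

section Gaussian

open scoped InnerProductSpace ComplexConjugate
open Module (finrank)

variable {E : Type*} [NormedAddCommGroup E] [InnerProductSpace ℝ E]

/-- The density of the Gaussian measure `N(μ, I)` with respect to `N(0, I)`. -/
def shiftDensity (μ z : E) : ℝ := Real.exp (⟪μ, z⟫_ℝ - ‖μ‖ ^ 2 / 2)

theorem shiftDensity_pos (μ z : E) : 0 < shiftDensity μ z := Real.exp_pos _

@[fun_prop]
theorem continuous_shiftDensity (μ : E) : Continuous (shiftDensity μ) := by
  unfold shiftDensity; fun_prop

theorem shiftDensity_mul_cexp (μ : E) (L : E →L[ℝ] ℂ) (z : E) :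
    (shiftDensity μ z : ℂ) * Complex.exp (L z) = Complex.exp (-(‖μ‖ ^ 2 / 2 : ℝ)) *
      Complex.exp ((L + (innerSL ℝ μ).smulRight (1 : ℂ)) z) := by
  rw [shiftDensity, Complex.ofReal_exp, ← Complex.exp_add, ← Complex.exp_add]
  simp only [Complex.ofReal_sub, Complex.ofReal_div, Complex.ofReal_pow, Complex.ofReal_ofNat,
    add_apply, ContinuousLinearMap.smulRight_apply, coe_innerSL_apply, Complex.real_smul, mul_one]
  ring_nf

theorem shiftDensity_mul_div (x y m z : E) :
    shiftDensity x z * shiftDensity y z / shiftDensity m z =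
      Real.exp (-((‖x‖ ^ 2 + ‖y‖ ^ 2 - ‖m‖ ^ 2) / 2)) * Real.exp ⟪x + y - m, z⟫_ℝ := by
  simp only [shiftDensity, ← Real.exp_add, ← Real.exp_sub, inner_sub_left, inner_add_left]
  ring_nf

theorem exp_mul_norm_le_prod {ι : Type*} [Fintype ι] (b : OrthonormalBasis ι ℝ E) {c : ℝ}
    (hc : 0 ≤ c) (x : E) :
    Real.exp (c * ‖x‖) ≤ ∏ i, (Real.exp (c * ⟪b i, x⟫_ℝ) + Real.exp (-c * ⟪b i, x⟫_ℝ)) := by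
  have norm_le_sum : ‖x‖ ≤ ∑ i, |⟪b i, x⟫_ℝ| := by
    conv_lhs => rw [← b.sum_repr' x]
    exact (norm_sum_le _ _).trans_eq (by simp [norm_smul])
  calc Real.exp (c * ‖x‖) ≤ Real.exp (∑ i, c * |⟪b i, x⟫_ℝ|) := by
        rw [← Finset.mul_sum]; gcongr
    _ = ∏ i, Real.exp (c * |⟪b i, x⟫_ℝ|) := Real.exp_sum _ _
    _ ≤ _ := Finset.prod_le_prod (fun _ _ => (Real.exp_pos _).le) fun i _ => by
        rcases abs_cases ⟪b i, x⟫_ℝ with ⟨h, -⟩ | ⟨h, -⟩ <;> rw [h]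
        · exact le_add_of_nonneg_right (Real.exp_pos _).le
        · rw [mul_neg, ← neg_mul]
          exact le_add_of_nonneg_left (Real.exp_pos _).le

/-- The functional `x ↦ (⟪g, x⟫ + i ⟪h, x⟫) / √2`. For independent standard Gaussian vectors `g`
and `h` it is a standard complex Gaussian functional. -/
def complexFunctional (g h : E) : E →L[ℝ] ℂ :=
  (√2)⁻¹ • ((innerSL ℝ g).smulRight (1 : ℂ) + (innerSL ℝ h).smulRight Complex.I)

theorem norm_complexFunctional_le (g h : E) : ‖complexFunctional g h‖ ≤ (√2)⁻¹ * (‖g‖ + ‖h‖) := by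
  rw [complexFunctional, norm_smul, Real.norm_of_nonneg (by positivity)]
  gcongr
  exact (norm_add_le _ _).trans_eq (by simp [ContinuousLinearMap.norm_smulRight_apply])

theorem cexp_complexFunctional_mul_conj (x y g h : E) :
    Complex.exp (complexFunctional g h x) * conj (Complex.exp (complexFunctional g h y)) =
      Complex.exp ((innerSL ℝ ((√2)⁻¹ • (x + y))).smulRight (1 : ℂ) g) *
        Complex.exp ((innerSL ℝ ((√2)⁻¹ • (x - y))).smulRight Complex.I h) := by
  rw [← Complex.exp_conj, ← Complex.exp_add, ← Complex.exp_add]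
  congr 1
  apply Complex.ext
  · simp [complexFunctional, real_inner_comm]
  · simp [complexFunctional, real_inner_comm, sub_eq_add_neg]

variable [FiniteDimensional ℝ E] [MeasurableSpace E] [BorelSpace E]

theorem integrable_prod_inner_stdGaussian {ι : Type*} [Fintype ι] (b : OrthonormalBasis ι ℝ E)
    {f : ι → ℝ → ℂ} (hf : ∀ i, Continuous (f i)) (hint : ∀ i, Integrable (f i) (gaussianReal 0 1)) :
    Integrable (fun x => ∏ i, f i ⟪b i, x⟫_ℝ) (stdGaussian E) := by
  rw [stdGaussian_eq_map_pi_orthonormalBasis b, integrable_map_measure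
    (Continuous.aestronglyMeasurable (by fun_prop)) (Measurable.aemeasurable (by fun_prop))]
  simpa [Function.comp_def, b.orthonormal.inner_right_fintype] using Integrable.fintype_prod hint

theorem integral_prod_inner_stdGaussian {ι : Type*} [Fintype ι] (b : OrthonormalBasis ι ℝ E)
    {f : ι → ℝ → ℂ} (hf : ∀ i, Continuous (f i)) :
    ∫ x, ∏ i, f i ⟪b i, x⟫_ℝ ∂stdGaussian E = ∏ i, ∫ t, f i t ∂gaussianReal 0 1 := by
  rw [stdGaussian_eq_map_pi_orthonormalBasis b, integral_map
    (Measurable.aemeasurable (by fun_prop)) (Continuous.aestronglyMeasurable (by fun_prop))]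
  simp only [b.orthonormal.inner_right_fintype]
  exact integral_fintype_prod_eq_prod f

theorem integrable_exp_strongDual (L : StrongDual ℝ E) :
    Integrable (fun x => Real.exp (L x)) (stdGaussian E) := by
  refine (integrable_map_measure (g := Real.exp) (f := L) ?_ L.continuous.aemeasurable).1 ?_
  · exact Real.continuous_exp.aestronglyMeasurable
  · rw [IsGaussian.map_eq_gaussianReal]
    simpa using integrable_exp_mul_gaussianReal (μ := (stdGaussian E)[L]) 1

theorem integral_exp_strongDual (L : StrongDual ℝ E) :
    ∫ x, Real.exp (L x) ∂stdGaussian E = Real.exp (‖L‖ ^ 2 / 2) := by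
  have := mgf_gaussianReal (IsGaussian.map_eq_gaussianReal (μ := stdGaussian E) L) 1
  simpa [mgf, variance_dual_stdGaussian] using this

theorem integrable_exp_inner (u : E) :
    Integrable (fun x => Real.exp ⟪u, x⟫_ℝ) (stdGaussian E) :=
  integrable_exp_strongDual (innerSL ℝ u)

theorem integral_exp_inner (u : E) :
    ∫ x, Real.exp ⟪u, x⟫_ℝ ∂stdGaussian E = Real.exp (‖u‖ ^ 2 / 2) := by
  simpa using integral_exp_strongDual (innerSL ℝ u)

theorem integrable_cexp_clm (L : E →L[ℝ] ℂ) :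
    Integrable (fun x => Complex.exp (L x)) (stdGaussian E) :=
  (integrable_exp_strongDual (Complex.reCLM ∘L L)).mono' (by fun_prop)
    (.of_forall fun x => (Complex.norm_exp _).le)

theorem integral_cexp_clm (b : OrthonormalBasis (Fin (finrank ℝ E)) ℝ E) (L : E →L[ℝ] ℂ) :
    ∫ x, Complex.exp (L x) ∂stdGaussian E = Complex.exp (∑ i, L (b i) ^ 2 / 2) := by
  have cexp_eq : ∀ x, Complex.exp (L x) = ∏ i, Complex.exp (L (b i) * ⟪b i, x⟫_ℝ) := fun x => by
    conv_lhs => rw [← b.sum_repr' x]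
    simp [← Complex.exp_sum, mul_comm]
  simp only [cexp_eq]
  rw [integral_prod_inner_stdGaussian b (f := fun i t => Complex.exp (L (b i) * t))
    (by fun_prop), Complex.exp_sum]
  exact Finset.prod_congr rfl fun i _ => by
    simpa [complexMGF] using complexMGF_id_gaussianReal (μ := 0) (v := 1) (L (b i))

theorem exp_neg_le_norm_integral_cexp_clm (L : E →L[ℝ] ℂ) :
    Real.exp (-(‖L‖ ^ 2 / 2)) ≤ ‖∫ x, Complex.exp (L x) ∂stdGaussian E‖ := by
  have norm_im_le : ‖Complex.imCLM ∘L L‖ ≤ ‖L‖ := by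
    simpa using ContinuousLinearMap.opNorm_comp_le Complex.imCLM L
  rw [integral_cexp_clm (stdOrthonormalBasis ℝ E), Complex.norm_exp, Real.exp_le_exp,
    Complex.re_sum]
  calc -(‖L‖ ^ 2 / 2) ≤ -(‖Complex.imCLM ∘L L‖ ^ 2 / 2) := by gcongr
    _ = ∑ i, -((L (stdOrthonormalBasis ℝ E i)).im ^ 2 / 2) := by
        rw [(stdOrthonormalBasis ℝ E).norm_dual, Finset.sum_div, Finset.sum_neg_distrib]
        simp
    _ ≤ _ := Finset.sum_le_sum fun i _ => by
        simp only [sq, Complex.div_ofNat_re, Complex.mul_re]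
        nlinarith [mul_self_nonneg (L (stdOrthonormalBasis ℝ E i)).re]

theorem integrable_shiftDensity_mul_cexp (μ : E) (L : E →L[ℝ] ℂ) :
    Integrable (fun z => (shiftDensity μ z : ℂ) * Complex.exp (L z)) (stdGaussian E) := by
  simp only [shiftDensity_mul_cexp]
  exact (integrable_cexp_clm _).const_mul _

theorem integral_shiftDensity_mul_cexp (μ : E) (L : E →L[ℝ] ℂ) :
    ∫ z, (shiftDensity μ z : ℂ) * Complex.exp (L z) ∂stdGaussian E =
      Complex.exp (L μ) * ∫ z, Complex.exp (L z) ∂stdGaussian E := by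
  let b := stdOrthonormalBasis ℝ E
  simp only [shiftDensity_mul_cexp]
  rw [integral_const_mul, integral_cexp_clm b, integral_cexp_clm b, ← Complex.exp_add,
    ← Complex.exp_add]
  have sum_inner_mul : L μ = ∑ i, L (b i) * ⟪μ, b i⟫_ℝ := by
    conv_lhs => rw [← b.sum_repr' μ]
    simp [mul_comm, real_inner_comm]
  have sum_inner_sq : ((‖μ‖ ^ 2 : ℝ) : ℂ) = ∑ i, (⟪μ, b i⟫_ℝ : ℂ) ^ 2 := by
    rw [← b.sum_sq_inner_left μ]; push_cast; rfl
  have expand : ∑ i, (L + (innerSL ℝ μ).smulRight (1 : ℂ)) (b i) ^ 2 / 2 =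
      ∑ i, L (b i) ^ 2 / 2 + L μ + (‖μ‖ ^ 2 : ℝ) / 2 := by
    rw [sum_inner_sq, sum_inner_mul, Finset.sum_div, ← Finset.sum_add_distrib,
      ← Finset.sum_add_distrib]
    refine Finset.sum_congr rfl fun i _ => ?_
    simp only [add_apply, ContinuousLinearMap.smulRight_apply, coe_innerSL_apply,
      Complex.real_smul, mul_one]
    ring
  rw [expand]
  push_cast
  ring_nf

theorem integrable_shiftDensity (μ : E) : Integrable (shiftDensity μ) (stdGaussian E) := by
  simpa using (integrable_shiftDensity_mul_cexp μ 0).re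

theorem map_add_stdGaussian (μ : E) :
    (stdGaussian E).map (μ + ·) =
      (stdGaussian E).withDensity fun z => ENNReal.ofReal (shiftDensity μ z) := by
  have : IsFiniteMeasure
      ((stdGaussian E).withDensity fun z => ENNReal.ofReal (shiftDensity μ z)) :=
    isFiniteMeasure_withDensity_ofReal (integrable_shiftDensity μ).2
  refine Measure.ext_of_charFun (funext fun t => ?_)
  let L : E →L[ℝ] ℂ := (innerSL ℝ t).smulRight Complex.I
  have L_apply : ∀ x, (⟪x, t⟫_ℝ : ℂ) * Complex.I = L x := fun x => by simp [L, real_inner_comm]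
  rw [charFun_apply, charFun_apply, integral_map (by fun_prop) (by fun_prop),
    integral_withDensity_eq_integral_toReal_smul (by fun_prop) (by simp)]
  simp only [L_apply, ENNReal.toReal_ofReal (shiftDensity_pos _ _).le, Complex.real_smul,
    integral_shiftDensity_mul_cexp, map_add, Complex.exp_add, integral_const_mul]

theorem integrable_shiftDensity_mul_div (x y m : E) :
    Integrable (fun z => shiftDensity x z * shiftDensity y z / shiftDensity m z)
      (stdGaussian E) := by
  simp only [shiftDensity_mul_div]
  exact (integrable_exp_inner _).const_mul _

theorem integral_shiftDensity_mul_div (x y m : E) :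
    ∫ z, shiftDensity x z * shiftDensity y z / shiftDensity m z ∂stdGaussian E =
      Real.exp ⟪x - m, y - m⟫_ℝ := by
  simp only [shiftDensity_mul_div]
  rw [integral_const_mul, integral_exp_inner, ← Real.exp_add]
  congr 1
  simp only [← real_inner_self_eq_norm_sq, inner_sub_left, inner_add_left, inner_sub_right,
    inner_add_right, real_inner_comm y x, real_inner_comm m x, real_inner_comm m y]
  ring

theorem integrable_exp_add_exp_neg (c : ℝ) :
    Integrable (fun t : ℝ => Real.exp (c * t) + Real.exp (-c * t)) (gaussianReal 0 1) :=
  (integrable_exp_mul_gaussianReal c).add (integrable_exp_mul_gaussianReal (-c))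

theorem integral_exp_add_exp_neg (c : ℝ) :
    ∫ t : ℝ, (Real.exp (c * t) + Real.exp (-c * t)) ∂gaussianReal 0 1 =
      2 * Real.exp (c ^ 2 / 2) := by
  have mgf_eq : ∀ s : ℝ, ∫ t : ℝ, Real.exp (s * t) ∂gaussianReal 0 1 = Real.exp (s ^ 2 / 2) :=
    fun s => by simpa [mgf] using congrFun (mgf_id_gaussianReal (μ := 0) (v := 1)) s
  rw [integral_add (integrable_exp_mul_gaussianReal c) (integrable_exp_mul_gaussianReal (-c)),
    mgf_eq, mgf_eq, neg_sq, two_mul]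

theorem integrable_prod_exp_add_exp_neg {ι : Type*} [Fintype ι] (b : OrthonormalBasis ι ℝ E)
    (c : ℝ) : Integrable
      (fun x => ∏ i, (Real.exp (c * ⟪b i, x⟫_ℝ) + Real.exp (-c * ⟪b i, x⟫_ℝ)))
      (stdGaussian E) := by
  have := (integrable_prod_inner_stdGaussian b
    (f := fun _ t => ((Real.exp (c * t) + Real.exp (-c * t) : ℝ) : ℂ)) (by fun_prop)
    fun _ => (integrable_exp_add_exp_neg c).ofReal).re
  simpa only [← Complex.ofReal_prod, RCLike.re_to_complex, Complex.ofReal_re] using this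

theorem integrable_exp_mul_norm {c : ℝ} (hc : 0 ≤ c) :
    Integrable (fun x => Real.exp (c * ‖x‖)) (stdGaussian E) :=
  (integrable_prod_exp_add_exp_neg (stdOrthonormalBasis ℝ E) c).mono' (by fun_prop)
    (.of_forall fun x => (Real.norm_of_nonneg (Real.exp_pos _).le).trans_le
      (exp_mul_norm_le_prod _ hc x))

theorem integral_exp_mul_norm_le {c : ℝ} (hc : 0 ≤ c) :
    ∫ x, Real.exp (c * ‖x‖) ∂stdGaussian E ≤ (2 * Real.exp (c ^ 2 / 2)) ^ finrank ℝ E := by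
  let b := stdOrthonormalBasis ℝ E
  calc ∫ x, Real.exp (c * ‖x‖) ∂stdGaussian E
      ≤ ∫ x, ∏ i, (Real.exp (c * ⟪b i, x⟫_ℝ) + Real.exp (-c * ⟪b i, x⟫_ℝ)) ∂stdGaussian E :=
        integral_mono (integrable_exp_mul_norm hc) (integrable_prod_exp_add_exp_neg b c)
          fun x => exp_mul_norm_le_prod b hc x
    _ = (2 * Real.exp (c ^ 2 / 2)) ^ finrank ℝ E := by
        have h := integral_prod_inner_stdGaussian b
          (f := fun _ t => ((Real.exp (c * t) + Real.exp (-c * t) : ℝ) : ℂ)) (by fun_prop)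
        simp only [← Complex.ofReal_prod, integral_complex_ofReal, Complex.ofReal_inj] at h
        rw [h]
        simp only [integral_exp_add_exp_neg, Finset.prod_const, Finset.card_univ,
          Fintype.card_fin]

theorem integrable_cexp_complexFunctional_mul_conj (x y : E) :
    Integrable (fun p : E × E => Complex.exp (complexFunctional p.1 p.2 x) *
      conj (Complex.exp (complexFunctional p.1 p.2 y)))
      ((stdGaussian E).prod (stdGaussian E)) := by
  simp only [cexp_complexFunctional_mul_conj]
  exact (integrable_cexp_clm _).mul_prod (integrable_cexp_clm _)

theorem integral_cexp_complexFunctional_mul_conj (x y : E) :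
    ∫ p : E × E, Complex.exp (complexFunctional p.1 p.2 x) *
      conj (Complex.exp (complexFunctional p.1 p.2 y)) ∂((stdGaussian E).prod (stdGaussian E)) =
      (Real.exp ⟪x, y⟫_ℝ : ℂ) := by
  let b := stdOrthonormalBasis ℝ E
  simp only [cexp_complexFunctional_mul_conj]
  rw [integral_prod_mul (fun g => Complex.exp ((innerSL ℝ ((√2)⁻¹ • (x + y))).smulRight 1 g))
    (fun h => Complex.exp ((innerSL ℝ ((√2)⁻¹ • (x - y))).smulRight Complex.I h)),
    integral_cexp_clm b, integral_cexp_clm b, ← Complex.exp_add, Complex.ofReal_exp,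
    ← b.sum_inner_mul_inner, ← Finset.sum_add_distrib, Complex.ofReal_sum]
  refine congrArg Complex.exp (Finset.sum_congr rfl fun i _ => ?_)
  simp only [ContinuousLinearMap.smulRight_apply, coe_innerSL_apply, Complex.real_smul, mul_one,
    mul_pow, Complex.I_sq, inner_smul_left, inner_add_left, inner_sub_left, real_inner_comm y,
    RCLike.conj_to_real, Complex.ofReal_mul, Complex.ofReal_add, Complex.ofReal_sub]
  have inv_sqrt_two_sq : (((√2)⁻¹ : ℝ) : ℂ) ^ 2 = 1 / 2 := by
    rw [← Complex.ofReal_pow, inv_pow, Real.sq_sqrt zero_le_two]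
    norm_num
  rw [inv_sqrt_two_sq]
  ring

theorem integral_norm_sum_mul_cexp_complexFunctional_sq {ι : Type*} (s : Finset ι) (a : ι → ℝ)
    (y : ι → E) :
    ∫ p : E × E, ‖∑ i ∈ s, (a i : ℂ) * Complex.exp (complexFunctional p.1 p.2 (y i))‖ ^ 2
      ∂((stdGaussian E).prod (stdGaussian E)) =
      ∑ i ∈ s, ∑ j ∈ s, a i * a j * Real.exp ⟪y i, y j⟫_ℝ := by
  have norm_sq_eq : ∀ p : E × E,
      ((‖∑ i ∈ s, (a i : ℂ) * Complex.exp (complexFunctional p.1 p.2 (y i))‖ ^ 2 : ℝ) : ℂ) =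
      ∑ i ∈ s, ∑ j ∈ s, ((a i * a j : ℝ) : ℂ) *
        (Complex.exp (complexFunctional p.1 p.2 (y i)) *
          conj (Complex.exp (complexFunctional p.1 p.2 (y j)))) := fun p => by
    rw [Complex.ofReal_pow, ← Complex.mul_conj', map_sum, Finset.sum_mul_sum]
    refine Finset.sum_congr rfl fun i _ => Finset.sum_congr rfl fun j _ => ?_
    rw [map_mul, Complex.conj_ofReal, mul_mul_mul_comm, Complex.ofReal_mul]
  have integrable_term := fun i j =>
    (integrable_cexp_complexFunctional_mul_conj (y i) (y j)).const_mul ((a i * a j : ℝ) : ℂ)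
  rw [← Complex.ofReal_inj, ← integral_complex_ofReal]
  simp only [norm_sq_eq]
  rw [integral_finsetSum _ fun i _ => integrable_finsetSum _ fun j _ => integrable_term i j,
    Complex.ofReal_sum]
  refine Finset.sum_congr rfl fun i _ => ?_
  rw [integral_finsetSum _ fun j _ => integrable_term i j, Complex.ofReal_sum]
  refine Finset.sum_congr rfl fun j _ => ?_
  rw [integral_const_mul, integral_cexp_complexFunctional_mul_conj, ← Complex.ofReal_mul]

theorem sum_mul_exp_inner_le {ι : Type*} (s : Finset ι) (a : ι → ℝ) (y : ι → E) {M c : ℝ}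
    (hc : 0 ≤ c) (h : ∀ L : E →L[ℝ] ℂ,
      ‖∑ i ∈ s, (a i : ℂ) * Complex.exp (L (y i))‖ ≤ M * Real.exp (c * ‖L‖)) :
    ∑ i ∈ s, ∑ j ∈ s, a i * a j * Real.exp ⟪y i, y j⟫_ℝ ≤
      M ^ 2 * (2 * Real.exp (c ^ 2)) ^ (2 * finrank ℝ E) := by
  have integrable_majorant : Integrable (fun x : E => Real.exp (√2 * c * ‖x‖)) (stdGaussian E) :=
    integrable_exp_mul_norm (by positivity)
  have pointwise : ∀ p : E × E,
      ‖∑ i ∈ s, (a i : ℂ) * Complex.exp (complexFunctional p.1 p.2 (y i))‖ ^ 2 ≤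
        M ^ 2 * (Real.exp (√2 * c * ‖p.1‖) * Real.exp (√2 * c * ‖p.2‖)) := fun p => by
    calc _ ≤ (M * Real.exp (c * ‖complexFunctional p.1 p.2‖)) ^ 2 := by gcongr; exact h _
      _ ≤ M ^ 2 * Real.exp (c * ((√2)⁻¹ * (‖p.1‖ + ‖p.2‖))) ^ 2 := by
          rw [mul_pow]; gcongr; exact norm_complexFunctional_le _ _
      _ = _ := by
          rw [← Real.exp_nat_mul, ← Real.exp_add]
          congr 2
          field_simp
          push_cast
          linear_combination (-c * ‖p.1‖ - c * ‖p.2‖) * Real.sq_sqrt zero_le_two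
  calc _ = ∫ p : E × E, ‖∑ i ∈ s, (a i : ℂ) * Complex.exp (complexFunctional p.1 p.2 (y i))‖ ^ 2
          ∂((stdGaussian E).prod (stdGaussian E)) :=
        (integral_norm_sum_mul_cexp_complexFunctional_sq s a y).symm
    _ ≤ ∫ p : E × E, M ^ 2 * (Real.exp (√2 * c * ‖p.1‖) * Real.exp (√2 * c * ‖p.2‖))
          ∂((stdGaussian E).prod (stdGaussian E)) :=
        integral_mono_of_nonneg (.of_forall fun p => by positivity)
          ((integrable_majorant.mul_prod integrable_majorant).const_mul _) (.of_forall pointwise)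
    _ = M ^ 2 * (∫ x : E, Real.exp (√2 * c * ‖x‖) ∂stdGaussian E) ^ 2 := by
        rw [integral_const_mul, integral_prod_mul (fun x : E => Real.exp (√2 * c * ‖x‖))
          (fun x : E => Real.exp (√2 * c * ‖x‖)), sq (∫ _, _ ∂_)]
    _ ≤ M ^ 2 * ((2 * Real.exp ((√2 * c) ^ 2 / 2)) ^ finrank ℝ E) ^ 2 := by
        gcongr
        exact integral_exp_mul_norm_le (by positivity)
    _ = M ^ 2 * (2 * Real.exp (c ^ 2)) ^ (2 * finrank ℝ E) := by
        rw [← pow_mul, mul_comm 2 (finrank ℝ E), mul_pow √2, Real.sq_sqrt zero_le_two,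
          mul_div_cancel_left₀ _ two_ne_zero]

theorem sum_mul_exp_inner_le_card {ι F : Type*} [NormedAddCommGroup F] [InnerProductSpace ℝ F]
    (s : Finset ι) (a : ι → ℝ) (y : ι → F) {M c : ℝ} (hc : 0 ≤ c) (h : ∀ L : F →L[ℝ] ℂ,
      ‖∑ i ∈ s, (a i : ℂ) * Complex.exp (L (y i))‖ ≤ M * Real.exp (c * ‖L‖)) :
    ∑ i ∈ s, ∑ j ∈ s, a i * a j * Real.exp ⟪y i, y j⟫_ℝ ≤
      M ^ 2 * (2 * Real.exp (c ^ 2)) ^ (2 * s.card) := by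
  classical
  let V : Submodule ℝ F := Submodule.span ℝ (s.image y)
  let proj : F →L[ℝ] V := V.orthogonalProjectionOnto
  have proj_eq : ∀ i ∈ s, (proj (y i) : F) = y i := fun i hi =>
    Submodule.starProjection_eq_self_iff.2
      (Submodule.subset_span (by exact_mod_cast Finset.mem_image_of_mem y hi))
  have norm_comp_le : ∀ L : V →L[ℝ] ℂ, ‖L ∘L proj‖ ≤ ‖L‖ := fun L =>
    (L.opNorm_comp_le _).trans (mul_le_of_le_one_right (norm_nonneg _)
      V.orthogonalProjectionOnto_norm_le)
  have finrank_le : finrank ℝ V ≤ s.card :=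
    (finrank_span_finset_le_card (s.image y)).trans Finset.card_image_le
  have M_nonneg : 0 ≤ M := by simpa using (norm_nonneg _).trans (h 0)
  borelize F
  calc ∑ i ∈ s, ∑ j ∈ s, a i * a j * Real.exp ⟪y i, y j⟫_ℝ
      = ∑ i ∈ s, ∑ j ∈ s, a i * a j * Real.exp ⟪proj (y i), proj (y j)⟫_ℝ :=
        Finset.sum_congr rfl fun i hi => Finset.sum_congr rfl fun j hj => by
          rw [Submodule.coe_inner, proj_eq i hi, proj_eq j hj]
    _ ≤ M ^ 2 * (2 * Real.exp (c ^ 2)) ^ (2 * finrank ℝ V) :=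
        sum_mul_exp_inner_le s a _ hc fun L => (h (L ∘L proj)).trans (by
          gcongr; exact norm_comp_le L)
    _ ≤ M ^ 2 * (2 * Real.exp (c ^ 2)) ^ (2 * s.card) := by
        gcongr
        linarith [Real.one_le_exp (sq_nonneg c)]

end Gaussian

/-! ### Hellinger distance -/

section Hellinger

variable {Ω : Type*} [MeasurableSpace Ω]

theorem integral_norm_mul_norm_le {ν : Measure Ω} {f g : Ω → ℝ} (hf : MemLp f 2 ν)
    (hg : MemLp g 2 ν) :
    ∫ x, ‖f x‖ * ‖g x‖ ∂ν ≤ √(∫ x, f x ^ 2 ∂ν) * √(∫ x, g x ^ 2 ∂ν) := by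
  simpa only [Real.rpow_two, Real.norm_eq_abs, sq_abs, ← Real.sqrt_eq_rpow] using
    integral_mul_norm_le_Lp_mul_Lq (E := ℝ) (f := f) (g := g) Real.HolderConjugate.two_two
      (by simpa using hf) (by simpa using hg)

theorem hellinger_nonneg (P Q : Measure Ω) : 0 ≤ hellinger P Q := Real.sqrt_nonneg _

theorem hellinger_sq_eq_integral_rnDeriv {P Q ν : Measure Ω} [SigmaFinite P] [SigmaFinite Q]
    [SigmaFinite ν] (hP : P ≪ ν) (hQ : Q ≪ ν) :
    hellinger P Q ^ 2 =
      ∫ x, (√(P.rnDeriv ν x).toReal - √(Q.rnDeriv ν x).toReal) ^ 2 ∂ν := by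
  have P_ac : P ≪ P + Q := (Measure.le_add_right le_rfl).absolutelyContinuous
  have Q_ac : Q ≪ P + Q := (Measure.le_add_left le_rfl).absolutelyContinuous
  rw [hellinger, Real.sq_sqrt (integral_nonneg fun _ => sq_nonneg _),
    ← integral_rnDeriv_smul (hP.add_left hQ)]
  refine integral_congr_ae ?_
  filter_upwards [Measure.rnDeriv_mul_rnDeriv (κ := ν) P_ac,
    Measure.rnDeriv_mul_rnDeriv (κ := ν) Q_ac] with x hPx hQx
  rw [← hPx, ← hQx, Pi.mul_apply, Pi.mul_apply, ENNReal.toReal_mul, ENNReal.toReal_mul,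
    Real.sqrt_mul ENNReal.toReal_nonneg, Real.sqrt_mul ENNReal.toReal_nonneg, ← sub_mul, mul_pow,
    Real.sq_sqrt ENNReal.toReal_nonneg, smul_eq_mul, mul_comm]

variable {ν : Measure Ω} {p q : Ω → ℝ}

theorem memLp_sqrt_sub_sqrt (hp : Measurable p) (hq : Measurable q) (hp₀ : ∀ x, 0 ≤ p x)
    (hq₀ : ∀ x, 0 ≤ q x) (hpq : Integrable (fun x => p x + q x) ν) :
    MemLp (fun x => √(p x) - √(q x)) 2 ν := by
  rw [memLp_two_iff_integrable_sq (Measurable.aestronglyMeasurable (by fun_prop))]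
  refine hpq.mono' (Measurable.aestronglyMeasurable (by fun_prop)) (.of_forall fun x => ?_)
  rw [Real.norm_of_nonneg (sq_nonneg _)]
  nlinarith [Real.sq_sqrt (hp₀ x), Real.sq_sqrt (hq₀ x),
    mul_nonneg (Real.sqrt_nonneg (p x)) (Real.sqrt_nonneg (q x))]

variable [SigmaFinite ν]

theorem hellinger_withDensity_sq (hp : Measurable p) (hq : Measurable q) :
    hellinger (ν.withDensity fun x => ENNReal.ofReal (p x))
      (ν.withDensity fun x => ENNReal.ofReal (q x)) ^ 2 = ∫ x, (√(p x) - √(q x)) ^ 2 ∂ν := by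
  have := SigmaFinite.withDensity_ofReal (μ := ν) p
  have := SigmaFinite.withDensity_ofReal (μ := ν) q
  rw [hellinger_sq_eq_integral_rnDeriv (withDensity_absolutelyContinuous ν _)
    (withDensity_absolutelyContinuous ν _)]
  refine integral_congr_ae ?_
  filter_upwards [Measure.rnDeriv_withDensity ν hp.ennreal_ofReal,
    Measure.rnDeriv_withDensity ν hq.ennreal_ofReal] with x hpx hqx
  rw [hpx, hqx]
  simp only [Real.sqrt, ENNReal.ofReal, ENNReal.coe_toReal, Real.toNNReal_coe]

theorem hellinger_withDensity_sq_le {W : Ω → ℝ} {c : ℝ} (hp : Measurable p) (hq : Measurable q)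
    (hp₀ : ∀ x, 0 ≤ p x) (hW₀ : ∀ x, 0 < W x) (hc : 0 < c) (hWq : ∀ x, W x ≤ c * q x)
    (hint : Integrable (fun x => (p x - q x) ^ 2 / W x) ν) :
    hellinger (ν.withDensity fun x => ENNReal.ofReal (p x))
      (ν.withDensity fun x => ENNReal.ofReal (q x)) ^ 2 ≤
      c * ∫ x, (p x - q x) ^ 2 / W x ∂ν := by
  rw [hellinger_withDensity_sq hp hq, ← integral_const_mul]
  refine integral_mono_of_nonneg (.of_forall fun x => sq_nonneg _) (hint.const_mul c)
    (.of_forall fun x => ?_)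
  have q_pos : 0 < q x := pos_of_mul_pos_right ((hW₀ x).trans_le (hWq x)) hc.le
  have factor : p x - q x = (√(p x) - √(q x)) * (√(p x) + √(q x)) := by
    rw [mul_comm, ← sq_sub_sq, Real.sq_sqrt (hp₀ x), Real.sq_sqrt q_pos.le]
  have q_le : q x ≤ (√(p x) + √(q x)) ^ 2 := by
    nlinarith [Real.sq_sqrt q_pos.le, Real.sqrt_nonneg (p x), Real.sqrt_nonneg (q x)]
  calc (√(p x) - √(q x)) ^ 2 = (√(p x) - √(q x)) ^ 2 * W x / W x := by
        rw [mul_div_cancel_right₀ _ (hW₀ x).ne']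
    _ ≤ (√(p x) - √(q x)) ^ 2 * (c * (√(p x) + √(q x)) ^ 2) / W x := by
        have := hW₀ x
        gcongr
        exact (hWq x).trans (by gcongr)
    _ = c * ((p x - q x) ^ 2 / W x) := by rw [factor]; ring

theorem norm_integral_sub_smul_le_hellinger {F : Type*} [NormedAddCommGroup F] [NormedSpace ℝ F]
    {f : Ω → F} (hp : Measurable p) (hq : Measurable q) (hp₀ : ∀ x, 0 ≤ p x) (hq₀ : ∀ x, 0 ≤ q x)
    (hpq : Integrable (fun x => p x + q x) ν) (hf : AEStronglyMeasurable f ν)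
    (hint : Integrable (fun x => (p x + q x) * ‖f x‖ ^ 2) ν) :
    ‖∫ x, (p x - q x) • f x ∂ν‖ ≤
      hellinger (ν.withDensity fun x => ENNReal.ofReal (p x))
        (ν.withDensity fun x => ENNReal.ofReal (q x)) *
        √(2 * ∫ x, (p x + q x) * ‖f x‖ ^ 2 ∂ν) := by
  have add_sq_le : ∀ x, ((√(p x) + √(q x)) * ‖f x‖) ^ 2 ≤ 2 * ((p x + q x) * ‖f x‖ ^ 2) :=
    fun x => by
    rw [mul_pow, ← mul_assoc]
    gcongr
    simpa only [Real.sq_sqrt (hp₀ x), Real.sq_sqrt (hq₀ x)] using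
      add_sq_le (a := √(p x)) (b := √(q x))
  have memLp_sub := memLp_sqrt_sub_sqrt hp hq hp₀ hq₀ hpq
  have measurable_add : Measurable fun x => √(p x) + √(q x) := by fun_prop
  have memLp_add : MemLp (fun x => (√(p x) + √(q x)) * ‖f x‖) 2 ν :=
    (memLp_two_iff_integrable_sq (measurable_add.aestronglyMeasurable.mul hf.norm)).2
      ((hint.const_mul 2).mono' ((measurable_add.aestronglyMeasurable.mul hf.norm).pow 2)
        (.of_forall fun x => (Real.norm_of_nonneg (sq_nonneg _)).trans_le (add_sq_le x)))
  calc ‖∫ x, (p x - q x) • f x ∂ν‖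
      ≤ ∫ x, ‖√(p x) - √(q x)‖ * ‖(√(p x) + √(q x)) * ‖f x‖‖ ∂ν := by
        refine (norm_integral_le_integral_norm _).trans_eq (integral_congr_ae (.of_forall
          fun x => ?_))
        dsimp only
        rw [norm_smul, ← norm_mul, ← mul_assoc, norm_mul _ ‖f x‖, norm_norm, mul_comm (_ - _),
          ← sq_sub_sq, Real.sq_sqrt (hp₀ x), Real.sq_sqrt (hq₀ x)]
    _ ≤ √(∫ x, (√(p x) - √(q x)) ^ 2 ∂ν) * √(∫ x, ((√(p x) + √(q x)) * ‖f x‖) ^ 2 ∂ν) := by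
        exact integral_norm_mul_norm_le memLp_sub memLp_add
    _ ≤ _ := by
        rw [← hellinger_withDensity_sq hp hq, Real.sqrt_sq (hellinger_nonneg _ _),
          ← integral_const_mul]
        exact mul_le_mul_of_nonneg_left (Real.sqrt_le_sqrt (integral_mono memLp_add.integrable_sq
          (hint.const_mul 2) add_sq_le)) (hellinger_nonneg _ _)

end Hellinger

/-! ### Densities of Gaussian mixtures -/

section Mixtures

open scoped InnerProductSpace

variable {E : Type*} [NormedAddCommGroup E] [InnerProductSpace ℝ E]

/-- The density with respect to `N(0, I)` of the convolution of `N(0, I)` with the signed measure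
`∑ x, a x • δ_x`, as a linear function of `a`. -/
def mixtureDensity (z : E) : (E →₀ ℝ) →ₗ[ℝ] ℝ :=
  Finsupp.linearCombination ℝ fun x => shiftDensity x z

theorem mixtureDensity_apply (z : E) (a : E →₀ ℝ) :
    mixtureDensity z a = ∑ x ∈ a.support, a x * shiftDensity x z := rfl

@[fun_prop]
theorem continuous_mixtureDensity (a : E →₀ ℝ) : Continuous fun z => mixtureDensity z a := by
  simp only [mixtureDensity_apply]; fun_prop

theorem mixtureDensity_nonneg {a : E →₀ ℝ} (ha : ∀ x, 0 ≤ a x) (z : E) :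
    0 ≤ mixtureDensity z a :=
  Finset.sum_nonneg fun x _ => mul_nonneg (ha x) (shiftDensity_pos x z).le

theorem mixtureDensity_mul_cexp (a : E →₀ ℝ) (L : E →L[ℝ] ℂ) (z : E) :
    (mixtureDensity z a : ℂ) * Complex.exp (L z) =
      ∑ x ∈ a.support, (a x : ℂ) * ((shiftDensity x z : ℂ) * Complex.exp (L z)) := by
  simp only [mixtureDensity_apply, Complex.ofReal_sum, Complex.ofReal_mul, Finset.sum_mul,
    mul_assoc]

theorem mixtureDensity_sq_div (a : E →₀ ℝ) (m z : E) :
    mixtureDensity z a ^ 2 / shiftDensity m z = ∑ x ∈ a.support, ∑ y ∈ a.support,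
      a x * a y * (shiftDensity x z * shiftDensity y z / shiftDensity m z) := by
  rw [mixtureDensity_apply, sq, Finset.sum_mul_sum, Finset.sum_div]
  refine Finset.sum_congr rfl fun x _ => ?_
  rw [Finset.sum_div]
  exact Finset.sum_congr rfl fun y _ => by rw [mul_mul_mul_comm, mul_div_assoc]

variable [FiniteDimensional ℝ E] [MeasurableSpace E] [BorelSpace E]

theorem integrable_mixtureDensity_mul_cexp (a : E →₀ ℝ) (L : E →L[ℝ] ℂ) :
    Integrable (fun z => (mixtureDensity z a : ℂ) * Complex.exp (L z)) (stdGaussian E) := by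
  simp only [mixtureDensity_mul_cexp]
  exact integrable_finsetSum _ fun x _ => (integrable_shiftDensity_mul_cexp x L).const_mul _

theorem integral_mixtureDensity_mul_cexp (a : E →₀ ℝ) (L : E →L[ℝ] ℂ) :
    ∫ z, (mixtureDensity z a : ℂ) * Complex.exp (L z) ∂stdGaussian E =
      laplace L a * ∫ z, Complex.exp (L z) ∂stdGaussian E := by
  simp only [mixtureDensity_mul_cexp]
  rw [integral_finsetSum _ fun x _ => (integrable_shiftDensity_mul_cexp x L).const_mul _,
    laplace_apply, Finset.sum_mul]
  exact Finset.sum_congr rfl fun x _ => by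
    rw [integral_const_mul, integral_shiftDensity_mul_cexp, mul_assoc]

theorem integrable_mixtureDensity (a : E →₀ ℝ) :
    Integrable (fun z => mixtureDensity z a) (stdGaussian E) := by
  simpa using (integrable_mixtureDensity_mul_cexp a 0).re

theorem integrable_mixtureDensity_mul_exp (a : E →₀ ℝ) (L : StrongDual ℝ E) :
    Integrable (fun z => mixtureDensity z a * Real.exp (L z)) (stdGaussian E) := by
  simpa [← Complex.ofReal_exp, ← Complex.ofReal_mul] using
    (integrable_mixtureDensity_mul_cexp a (Complex.ofRealCLM ∘L L)).re

theorem integral_mixtureDensity_mul_exp (a : E →₀ ℝ) (L : StrongDual ℝ E) :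
    ∫ z, mixtureDensity z a * Real.exp (L z) ∂stdGaussian E =
      (∑ x ∈ a.support, a x * Real.exp (L x)) * Real.exp (‖L‖ ^ 2 / 2) := by
  have h := integral_mixtureDensity_mul_cexp a (Complex.ofRealCLM ∘L L)
  simp only [ContinuousLinearMap.comp_apply, Complex.ofRealCLM_apply, ← Complex.ofReal_exp,
    ← Complex.ofReal_mul, integral_complex_ofReal, laplace_apply, ← Complex.ofReal_sum,
    Complex.ofReal_inj, integral_exp_strongDual] at h
  exact h

theorem integrable_mixtureDensity_sq_div (a : E →₀ ℝ) (m : E) :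
    Integrable (fun z => mixtureDensity z a ^ 2 / shiftDensity m z) (stdGaussian E) := by
  simp only [mixtureDensity_sq_div]
  exact integrable_finsetSum _ fun x _ => integrable_finsetSum _ fun y _ =>
    (integrable_shiftDensity_mul_div x y m).const_mul _

theorem integral_mixtureDensity_sq_div (a : E →₀ ℝ) (m : E) :
    ∫ z, mixtureDensity z a ^ 2 / shiftDensity m z ∂stdGaussian E =
      ∑ x ∈ a.support, ∑ y ∈ a.support, a x * a y * Real.exp ⟪x - m, y - m⟫_ℝ := by
  have integrable_term := fun x y =>
    (integrable_shiftDensity_mul_div x y m).const_mul (a x * a y)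
  simp only [mixtureDensity_sq_div]
  rw [integral_finsetSum _ fun x _ => integrable_finsetSum _ fun y _ => integrable_term x y]
  refine Finset.sum_congr rfl fun x _ => ?_
  rw [integral_finsetSum _ fun y _ => integrable_term x y]
  exact Finset.sum_congr rfl fun y _ => by
    rw [integral_const_mul, integral_shiftDensity_mul_div]

/-- The Gaussian location mixture with mixing distribution `∑ x, a x • δ_x`. It is defined through
its density and meaningful only for nonnegative `a`. -/
def law (a : E →₀ ℝ) : Measure E :=
  (stdGaussian E).withDensity fun z => ENNReal.ofReal (mixtureDensity z a)

theorem mixture_sum_smul_dirac {d k : ℕ} (w : Fin k → ℝ≥0) (μ : Fin k → EuclideanSpace ℝ (Fin d)) :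
    mixture (∑ j, w j • Measure.dirac (μ j)) =
      law (∑ j, Finsupp.single (μ j) (w j : ℝ)) := by
  have density_eq : ∀ z, ENNReal.ofReal (mixtureDensity z (∑ j, Finsupp.single (μ j) (w j : ℝ))) =
      ∑ j, (w j : ℝ≥0∞) * ENNReal.ofReal (shiftDensity (μ j) z) := fun z => by
    simp only [mixtureDensity, map_sum, Finsupp.linearCombination_single, smul_eq_mul]
    rw [ENNReal.ofReal_sum_of_nonneg (f := fun j => (w j : ℝ) * shiftDensity (μ j) z)
      fun j _ => mul_nonneg (w j).coe_nonneg (shiftDensity_pos _ _).le]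
    exact Finset.sum_congr rfl fun j _ => by
      rw [ENNReal.ofReal_mul (w j).coe_nonneg, ENNReal.ofReal_coe_nnreal]
  refine Measure.ext_of_lintegral _ fun f hf => ?_
  rw [mixture, law, Measure.lintegral_conv hf, lintegral_finsetSum_measure,
    lintegral_withDensity_eq_lintegral_mul _ (by fun_prop) hf]
  simp only [Pi.mul_apply, density_eq, Finset.sum_mul, mul_assoc]
  rw [lintegral_finsetSum _ fun j _ => by fun_prop]
  refine Finset.sum_congr rfl fun j _ => ?_
  rw [lintegral_smul_measure, lintegral_dirac' _ (by fun_prop), lintegral_const_mul _ (by fun_prop),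
    ← lintegral_map hf (by fun_prop), map_add_stdGaussian,
    lintegral_withDensity_eq_lintegral_mul _ (by fun_prop) hf]
  rfl

end Mixtures

/-! ### Probability measures with few atoms -/

section Mixing

variable {E : Type*} [NormedAddCommGroup E] {R : ℝ} {k : ℕ} {a a' : E →₀ ℝ}

/-- The signed measure `∑ x, a x • δ_x` is a probability measure with at most `k` atoms, all of
them in the closed ball of radius `R` about the origin. -/
structure IsMixing (R : ℝ) (k : ℕ) (a : E →₀ ℝ) : Prop where
  nonneg : ∀ x, 0 ≤ a x
  sum_eq_one : ∑ x ∈ a.support, a x = 1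
  card_support_le : a.support.card ≤ k
  norm_le : ∀ x ∈ a.support, ‖x‖ ≤ R

theorem isMixing_sum_single {w : Fin k → ℝ≥0} {μ : Fin k → E} (hw : ∑ j, w j = 1)
    (hμ : ∀ j, ‖μ j‖ ≤ R) : IsMixing R k (∑ j, Finsupp.single (μ j) (w j : ℝ)) := by
  classical
  have support_subset : (∑ j, Finsupp.single (μ j) (w j : ℝ)).support ⊆ Finset.univ.image μ :=
    Finsupp.support_finsetSum.trans (Finset.biUnion_subset.2 fun j _ =>
      Finsupp.support_single_subset.trans (by simp))
  refine ⟨fun x => ?_, ?_, ?_, fun x hx => ?_⟩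
  · simp only [Finsupp.finsetSum_apply]
    exact Finset.sum_nonneg fun j _ => Finsupp.single_nonneg.2 (w j).coe_nonneg x
  · have mass_eq : ∀ b : E →₀ ℝ,
        ∑ x ∈ b.support, b x = Finsupp.linearCombination ℝ (fun _ => (1 : ℝ)) b := fun b => by
      simp [Finsupp.linearCombination_apply, Finsupp.sum]
    simp only [mass_eq, map_sum, Finsupp.linearCombination_single, smul_eq_mul, mul_one]
    exact_mod_cast hw
  · simpa using (Finset.card_le_card support_subset).trans Finset.card_image_le
  · obtain ⟨j, -, rfl⟩ := Finset.mem_image.1 (support_subset hx)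
    exact hμ j

namespace IsMixing

theorem support_nonempty (ha : IsMixing R k a) : a.support.Nonempty :=
  Finset.nonempty_of_sum_ne_zero (ha.sum_eq_one.trans_ne one_ne_zero)

theorem radius_nonneg (ha : IsMixing R k a) : 0 ≤ R :=
  let ⟨x, hx⟩ := ha.support_nonempty
  (norm_nonneg x).trans (ha.norm_le x hx)

theorem sum_mul_le (ha : IsMixing R k a) {f : E → ℝ} {C : ℝ} (hf : ∀ x, ‖x‖ ≤ R → f x ≤ C) :
    ∑ x ∈ a.support, a x * f x ≤ C := calc
  ∑ x ∈ a.support, a x * f x ≤ ∑ x ∈ a.support, a x * C := by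
    gcongr with x hx
    · exact ha.nonneg x
    · exact hf x (ha.norm_le x hx)
  _ = C := by rw [← Finset.sum_mul, ha.sum_eq_one, one_mul]

theorem card_support_sub_le (ha : IsMixing R k a) (ha' : IsMixing R k a') :
    (a - a').support.card ≤ 2 * k := by
  classical
  refine (Finset.card_le_card Finsupp.support_sub).trans ((Finset.card_union_le _ _).trans ?_)
  linarith [ha.card_support_le, ha'.card_support_le]

theorem norm_le_of_mem_support_sub (ha : IsMixing R k a) (ha' : IsMixing R k a') {x : E}
    (hx : x ∈ (a - a').support) : ‖x‖ ≤ R := by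
  classical
  exact (Finset.mem_union.1 (Finsupp.support_sub hx)).elim (ha.norm_le x) (ha'.norm_le x)

theorem norm_mean_le [NormedSpace ℝ E] (ha : IsMixing R k a) : ‖∑ x ∈ a.support, a x • x‖ ≤ R := by
  refine (norm_sum_le _ _).trans ?_
  simp only [norm_smul, Real.norm_of_nonneg (ha.nonneg _)]
  exact ha.sum_mul_le fun x hx => hx

end IsMixing

end Mixing

/-! ### Hellinger distance versus moments -/

section Comparison

open scoped InnerProductSpace

theorem norm_cexp_sq {E : Type*} [NormedAddCommGroup E] [NormedSpace ℝ E] (L : E →L[ℝ] ℂ)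
    (z : E) :
    ‖Complex.exp (L z)‖ ^ 2 = Real.exp (((2 : ℝ) • (Complex.reCLM ∘L L)) z) := by
  rw [Complex.norm_exp, ← Real.exp_nat_mul]; rfl

variable {E : Type*} [NormedAddCommGroup E] [InnerProductSpace ℝ E] {R : ℝ} {k : ℕ}
  {a a' : E →₀ ℝ}

theorem IsMixing.shiftDensity_mean_le (ha : IsMixing R k a) (z : E) :
    shiftDensity (∑ x ∈ a.support, a x • x) z ≤ Real.exp (R ^ 2 / 2) * mixtureDensity z a := by
  rw [mixtureDensity_apply, Finset.mul_sum]
  calc shiftDensity (∑ x ∈ a.support, a x • x) z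
      ≤ Real.exp (∑ x ∈ a.support, a x • ⟪x, z⟫_ℝ) := by
        rw [shiftDensity, sum_inner]
        simp only [real_inner_smul_left, smul_eq_mul]
        gcongr
        exact sub_le_self _ (by positivity)
    _ ≤ ∑ x ∈ a.support, a x • Real.exp ⟪x, z⟫_ℝ :=
        convexOn_exp.map_sum_le (fun x _ => ha.nonneg x) ha.sum_eq_one fun _ _ => Set.mem_univ _
    _ ≤ ∑ x ∈ a.support, Real.exp (R ^ 2 / 2) * (a x * shiftDensity x z) := by
        refine Finset.sum_le_sum fun x hx => ?_
        rw [smul_eq_mul, mul_left_comm, shiftDensity, ← Real.exp_add]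
        have := ha.norm_le x hx
        have := ha.nonneg x
        gcongr
        linarith [pow_le_pow_left₀ (norm_nonneg x) ‹‖x‖ ≤ R› 2]

theorem IsMixing.norm_laplace_sub_le_of_powerMoment (ha : IsMixing R k a) (ha' : IsMixing R k a')
    {M : ℝ} (hM : 0 ≤ M)
    (hmoment : ∀ l < 2 * k, ∀ L : E →L[ℝ] ℂ, ‖L‖ ≤ 1 → ‖powerMoment l L (a - a')‖ ≤ M)
    {m : E} (hm : ‖m‖ ≤ R) (L : E →L[ℝ] ℂ) :
    ‖∑ x ∈ (a - a').support, ((a - a') x : ℂ) * Complex.exp (L (x - m))‖ ≤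
      M * Real.exp ((1 + 3 * R) * ‖L‖) := by
  have laplace_le := norm_laplace_le_of_norm_powerMoment_le ha.radius_nonneg hM
    (fun x hx => ha.norm_le_of_mem_support_sub ha' hx)
    (fun l hl => hmoment l (hl.trans_le (ha.card_support_sub_le ha'))) L
  have re_le : (-L m).re ≤ R * ‖L‖ := calc
    (-L m).re ≤ ‖-L m‖ := Complex.re_le_norm _
    _ = ‖L m‖ := norm_neg _
    _ ≤ ‖L‖ * R := L.le_of_opNorm_le_of_le le_rfl hm
    _ = R * ‖L‖ := mul_comm _ _
  calc _ = ‖Complex.exp (-L m)‖ * ‖laplace L (a - a')‖ := by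
        rw [← norm_mul, laplace_apply, Finset.mul_sum]
        congr 1
        refine Finset.sum_congr rfl fun x _ => ?_
        rw [map_sub, sub_eq_neg_add (L x), Complex.exp_add, mul_left_comm]
    _ ≤ Real.exp (R * ‖L‖) * (M * Real.exp ((1 + 2 * R) * ‖L‖)) := by
        rw [Complex.norm_exp]; gcongr
    _ = M * Real.exp ((1 + 3 * R) * ‖L‖) := by
        rw [mul_left_comm, ← Real.exp_add]; ring_nf

variable [FiniteDimensional ℝ E] [MeasurableSpace E] [BorelSpace E]

theorem integrable_mixtureDensity_mul_norm_cexp_sq (a : E →₀ ℝ) (L : E →L[ℝ] ℂ) :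
    Integrable (fun z => mixtureDensity z a * ‖Complex.exp (L z)‖ ^ 2) (stdGaussian E) := by
  simp only [norm_cexp_sq]
  exact integrable_mixtureDensity_mul_exp a _

theorem IsMixing.integral_mixtureDensity_mul_norm_cexp_sq_le (ha : IsMixing R k a)
    (L : E →L[ℝ] ℂ) :
    ∫ z, mixtureDensity z a * ‖Complex.exp (L z)‖ ^ 2 ∂stdGaussian E ≤
      Real.exp (R * ‖L‖ + ‖L‖ ^ 2) ^ 2 := by
  let ℓ : StrongDual ℝ E := (2 : ℝ) • (Complex.reCLM ∘L L)
  have norm_ℓ : ‖ℓ‖ ≤ 2 * ‖L‖ := by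
    rw [norm_smul, Real.norm_two]
    gcongr
    simpa using ContinuousLinearMap.opNorm_comp_le Complex.reCLM L
  have sum_le : ∑ x ∈ a.support, a x * Real.exp (ℓ x) ≤ Real.exp (‖ℓ‖ * R) :=
    ha.sum_mul_le fun x hx => Real.exp_le_exp.2
      ((Real.le_norm_self _).trans (ℓ.le_of_opNorm_le_of_le le_rfl hx))
  have := ha.radius_nonneg
  simp only [norm_cexp_sq]
  calc ∫ z, mixtureDensity z a * Real.exp (ℓ z) ∂stdGaussian E
      ≤ Real.exp (‖ℓ‖ * R) * Real.exp (‖ℓ‖ ^ 2 / 2) := by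
        rw [integral_mixtureDensity_mul_exp]; gcongr
    _ ≤ Real.exp (2 * ‖L‖ * R) * Real.exp ((2 * ‖L‖) ^ 2 / 2) := by gcongr
    _ = Real.exp (R * ‖L‖ + ‖L‖ ^ 2) ^ 2 := by
        rw [← Real.exp_add, ← Real.exp_nat_mul]; ring_nf

theorem IsMixing.norm_laplace_sub_le (ha : IsMixing R k a) (ha' : IsMixing R k a')
    (L : E →L[ℝ] ℂ) :
    ‖laplace L (a - a')‖ ≤
      2 * Real.exp (R * ‖L‖ + 3 * ‖L‖ ^ 2 / 2) * hellinger (law a) (law a') := by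
  have integrable_a := integrable_mixtureDensity_mul_norm_cexp_sq a L
  have integrable_a' := integrable_mixtureDensity_mul_norm_cexp_sq a' L
  have cauchy_schwarz := norm_integral_sub_smul_le_hellinger (ν := stdGaussian E)
    (f := fun z => Complex.exp (L z)) (continuous_mixtureDensity a).measurable
    (continuous_mixtureDensity a').measurable (mixtureDensity_nonneg ha.nonneg)
    (mixtureDensity_nonneg ha'.nonneg)
    ((integrable_mixtureDensity a).add (integrable_mixtureDensity a')) (by fun_prop)
    (by simp only [add_mul]; exact integrable_a.add integrable_a')
  simp only [← map_sub, Complex.real_smul, integral_mixtureDensity_mul_cexp, norm_mul,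
    add_mul] at cauchy_schwarz
  rw [integral_add integrable_a integrable_a'] at cauchy_schwarz
  have laplace_mul_le : ‖laplace L (a - a')‖ * Real.exp (-(‖L‖ ^ 2 / 2)) ≤
      hellinger (law a) (law a') * (2 * Real.exp (R * ‖L‖ + ‖L‖ ^ 2)) := calc
    _ ≤ ‖laplace L (a - a')‖ * ‖∫ z, Complex.exp (L z) ∂stdGaussian E‖ := by
      gcongr; exact exp_neg_le_norm_integral_cexp_clm L
    _ ≤ _ := cauchy_schwarz
    _ ≤ _ := by
      refine mul_le_mul_of_nonneg_left (Real.sqrt_le_iff.2 ⟨by positivity, ?_⟩)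
        (hellinger_nonneg _ _)
      linarith [ha.integral_mixtureDensity_mul_norm_cexp_sq_le L,
        ha'.integral_mixtureDensity_mul_norm_cexp_sq_le L]
  calc ‖laplace L (a - a')‖
      = ‖laplace L (a - a')‖ * Real.exp (-(‖L‖ ^ 2 / 2)) * Real.exp (‖L‖ ^ 2 / 2) := by
        rw [mul_assoc, ← Real.exp_add, neg_add_cancel, Real.exp_zero, mul_one]
    _ ≤ hellinger (law a) (law a') * (2 * Real.exp (R * ‖L‖ + ‖L‖ ^ 2)) *
          Real.exp (‖L‖ ^ 2 / 2) := by gcongr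
    _ = _ := by
        rw [mul_comm (hellinger _ _), mul_right_comm, mul_assoc 2, ← Real.exp_add]
        ring_nf

theorem IsMixing.norm_powerMoment_sub_le (ha : IsMixing R k a) (ha' : IsMixing R k a') {r : ℝ}
    (l : ℕ) {L : E →L[ℝ] ℂ} (hL : ‖L‖ ≤ r) :
    ‖powerMoment l L (a - a')‖ ≤ l.factorial *
      (2 * Real.exp (R * r + 3 * r ^ 2 / 2) * hellinger (law a) (law a')) := by
  refine norm_powerMoment_le_of_norm_laplace_le (fun L hL => ?_) l hL
  refine (ha.norm_laplace_sub_le ha' L).trans ?_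
  have := ha.radius_nonneg
  have := hellinger_nonneg (law a) (law a')
  gcongr

/-- The factor by which the Hellinger distance of two `k`-atomic mixtures can exceed the moments
of order less than `2 * k` of the difference of their mixing distributions. -/
def comparisonConst (R : ℝ) (k : ℕ) : ℝ :=
  Real.exp (R ^ 2 / 4) * (2 * Real.exp ((1 + 3 * R) ^ 2)) ^ (2 * k)

theorem comparisonConst_pos (R : ℝ) (k : ℕ) : 0 < comparisonConst R k := by
  unfold comparisonConst; positivity

theorem IsMixing.hellinger_law_le (ha : IsMixing R k a) (ha' : IsMixing R k a') {M : ℝ}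
    (hM : 0 ≤ M)
    (hmoment : ∀ l < 2 * k, ∀ L : E →L[ℝ] ℂ, ‖L‖ ≤ 1 → ‖powerMoment l L (a - a')‖ ≤ M) :
    hellinger (law a) (law a') ≤ comparisonConst R k * M := by
  -- By convexity of `exp`, the Gaussian centred at the mean is dominated by the mixture itself.
  let m := ∑ x ∈ a'.support, a' x • x
  have gram_le := sum_mul_exp_inner_le_card (a - a').support (a - a') (· - m)
    (by have := ha.radius_nonneg; positivity)
    (ha.norm_laplace_sub_le_of_powerMoment ha' hM hmoment ha'.norm_mean_le)
  have hellinger_sq_le := hellinger_withDensity_sq_le (W := shiftDensity m)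
    (continuous_mixtureDensity a).measurable (continuous_mixtureDensity a').measurable
    (mixtureDensity_nonneg ha.nonneg) (shiftDensity_pos m) (Real.exp_pos _)
    ha'.shiftDensity_mean_le
    (by simpa only [← map_sub] using integrable_mixtureDensity_sq_div (a - a') m)
  simp only [← map_sub, integral_mixtureDensity_sq_div] at hellinger_sq_le
  have one_le : 1 ≤ 2 * Real.exp ((1 + 3 * R) ^ 2) := by
    linarith [Real.one_le_exp (sq_nonneg (1 + 3 * R))]
  refine le_of_sq_le_sq ?_ (mul_nonneg (comparisonConst_pos R k).le hM)
  calc hellinger (law a) (law a') ^ 2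
      ≤ Real.exp (R ^ 2 / 2) * (M ^ 2 * (2 * Real.exp ((1 + 3 * R) ^ 2)) ^ (2 * (2 * k))) := by
        refine hellinger_sq_le.trans ?_
        gcongr
        refine gram_le.trans ?_
        gcongr
        exact ha.card_support_sub_le ha'
    _ = (comparisonConst R k * M) ^ 2 := by
        have exp_eq : Real.exp (R ^ 2 / 2) = Real.exp (R ^ 2 / 4) ^ 2 := by
          rw [← Real.exp_nat_mul]; ring_nf
        rw [comparisonConst, exp_eq]
        ring

end Comparison

/-! ### Moments in coordinates -/

section Coordinates

open Module (finrank)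
open ContinuousLinearMap (adjoint)

variable {n l : ℕ}

/-- The unit ball of the space of complex-valued functionals on `ℝⁿ`, on which moments are
evaluated. -/
abbrev UnitFunctionals (n : ℕ) : Type :=
  Metric.closedBall (0 : EuclideanSpace ℝ (Fin n) →L[ℝ] ℂ) 1

instance : CompactSpace (UnitFunctionals n) :=
  isCompact_iff_compactSpace.1 (isCompact_closedBall _ _)

/-- The monomial `L ↦ ∏ j, L (e (p j))` of degree `l` in the values of a functional `L` at the
standard basis `e` of `ℝⁿ`. -/
def monomial (p : Fin l → Fin n) : C(UnitFunctionals n, ℂ) where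
  toFun L := ∏ j, L.1 (EuclideanSpace.basisFun (Fin n) ℝ (p j))

/-- The real vector space of homogeneous polynomials of degree `l` in the values of a functional at
the standard basis of `ℝⁿ`. -/
def momentSpace (n l : ℕ) : Submodule ℝ C(UnitFunctionals n, ℂ) :=
  Submodule.span ℝ (Set.range (monomial (n := n) (l := l)))

instance : FiniteDimensional ℝ (momentSpace n l) :=
  FiniteDimensional.span_of_finite ℝ (Set.finite_range _)

theorem finrank_momentSpace_le : finrank ℝ (momentSpace n l) ≤ n ^ l :=
  (finrank_range_le_card _).trans_eq (by simp)

theorem finrank_pi_momentSpace_le : finrank ℝ (∀ l : Fin n, momentSpace n l) ≤ n ^ n := by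
  rw [Module.finrank_pi_fintype]
  calc ∑ l : Fin n, finrank ℝ (momentSpace n l) ≤ ∑ l : Fin n, n ^ (l : ℕ) :=
        Finset.sum_le_sum fun _ _ => finrank_momentSpace_le
    _ = ∑ l ∈ Finset.range n, n ^ l := Fin.sum_univ_eq_sum_range (n ^ ·) n
    _ ≤ n ^ n := by
        rcases lt_or_ge n 2 with h | h
        · interval_cases n <;> simp
        · exact (Nat.geomSum_lt h fun _ => Finset.mem_range.1).le

/-- The evaluation `L ↦ (L z) ^ l`. -/
def evalPow (l : ℕ) (z : EuclideanSpace ℝ (Fin n)) : C(UnitFunctionals n, ℂ) where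
  toFun L := L.1 z ^ l

theorem evalPow_mem_momentSpace (z : EuclideanSpace ℝ (Fin n)) :
    evalPow l z ∈ momentSpace n l := by
  have expand : evalPow l z = ∑ p : Fin l → Fin n, (∏ j, z (p j)) • monomial p := by
    ext L
    have L_eq : L.1 z = ∑ i, z i • L.1 (EuclideanSpace.basisFun (Fin n) ℝ i) := by
      conv_lhs => rw [← (EuclideanSpace.basisFun (Fin n) ℝ).sum_repr z]
      simp
    simp [evalPow, monomial, L_eq, Fintype.sum_pow, Finset.prod_mul_distrib]
  rw [expand]
  exact Submodule.sum_mem _ fun p _ => Submodule.smul_mem _ _ (Submodule.subset_span ⟨p, rfl⟩)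

/-- The moments of order less than `n` of a finitely supported signed measure on `ℝⁿ`. -/
def moments (n : ℕ) : (EuclideanSpace ℝ (Fin n) →₀ ℝ) →ₗ[ℝ] ∀ l : Fin n, momentSpace n l :=
  LinearMap.pi fun l =>
    Finsupp.linearCombination ℝ fun z => ⟨evalPow l z, evalPow_mem_momentSpace z⟩

theorem moments_apply (D : EuclideanSpace ℝ (Fin n) →₀ ℝ) (l : Fin n) (L : UnitFunctionals n) :
    (moments n D l : C(UnitFunctionals n, ℂ)) L = powerMoment l L.1 D := by
  simp [moments, powerMoment, Finsupp.linearCombination_apply, Finsupp.sum, evalPow]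

theorem norm_powerMoment_le_norm_moments (D : EuclideanSpace ℝ (Fin n) →₀ ℝ) (hl : l < n)
    {L : EuclideanSpace ℝ (Fin n) →L[ℝ] ℂ} (hL : ‖L‖ ≤ 1) :
    ‖powerMoment l L D‖ ≤ ‖moments n D‖ := by
  rw [← moments_apply D ⟨l, hl⟩ ⟨L, mem_closedBall_zero_iff.2 hL⟩]
  exact (ContinuousMap.norm_coe_le_norm _ _).trans (norm_le_pi_norm (moments n D) ⟨l, hl⟩)

theorem norm_moments_le {D : EuclideanSpace ℝ (Fin n) →₀ ℝ} {B : ℝ} (hB : 0 ≤ B)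
    (h : ∀ l < n, ∀ L : EuclideanSpace ℝ (Fin n) →L[ℝ] ℂ, ‖L‖ ≤ 1 → ‖powerMoment l L D‖ ≤ B) :
    ‖moments n D‖ ≤ B :=
  (pi_norm_le_iff_of_nonneg hB).2 fun l => (ContinuousMap.norm_le _ hB).2 fun L =>
    (congrArg norm (moments_apply D l L)).trans_le (h l l.2 _ (mem_closedBall_zero_iff.1 L.2))

theorem powerMoment_mapDomain {E F : Type*} [NormedAddCommGroup E] [NormedSpace ℝ E]
    [NormedAddCommGroup F] [NormedSpace ℝ F] (L : F →L[ℝ] ℂ) (T : E →L[ℝ] F) (D : E →₀ ℝ) :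
    powerMoment l L (D.mapDomain T) = powerMoment l (L ∘L T) D := by
  simp only [powerMoment, Finsupp.linearCombination_mapDomain]; rfl

variable {E F : Type*} [NormedAddCommGroup E] [InnerProductSpace ℝ E] [CompleteSpace E]
  [NormedAddCommGroup F] [InnerProductSpace ℝ F] [CompleteSpace F]

/-- The contraction `S : F → E` provides coordinates for the atoms of the signed measure
`∑ x, D x • δ_x`: every atom is recovered from its coordinate vector `S† x`. -/
structure Captures (S : F →L[ℝ] E) (D : E →₀ ℝ) : Prop where
  norm_le : ‖S‖ ≤ 1
  apply_adjoint : ∀ x ∈ D.support, S (adjoint S x) = x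

namespace Captures

variable {S S' : F →L[ℝ] E} {D D' : E →₀ ℝ}

theorem norm_comp_le (hS : Captures S D) (L : E →L[ℝ] ℂ) : ‖L ∘L S‖ ≤ ‖L‖ :=
  (L.opNorm_comp_le S).trans (mul_le_of_le_one_right (norm_nonneg L) hS.norm_le)

theorem norm_comp_adjoint_le (hS : Captures S D) (L : F →L[ℝ] ℂ) : ‖L ∘L adjoint S‖ ≤ ‖L‖ :=
  (L.opNorm_comp_le _).trans (mul_le_of_le_one_right (norm_nonneg L)
    ((adjoint.norm_map S).trans_le hS.norm_le))

theorem powerMoment_comp (hS : Captures S D) (L : E →L[ℝ] ℂ) :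
    powerMoment l ((L ∘L S) ∘L adjoint S) D = powerMoment l L D := by
  rw [powerMoment_apply, powerMoment_apply]
  refine Finset.sum_congr rfl fun x hx => ?_
  rw [ContinuousLinearMap.comp_apply, ContinuousLinearMap.comp_apply, hS.apply_adjoint x hx]

theorem norm_powerMoment_sub_le {S S' : EuclideanSpace ℝ (Fin n) →L[ℝ] E} (hS : Captures S D)
    (hS' : Captures S' D') {B : ℝ} (hl : l < n)
    (hB : ∀ L : E →L[ℝ] ℂ, ‖L‖ ≤ 2 → ‖powerMoment l L D'‖ ≤ B) {L : E →L[ℝ] ℂ} (hL : ‖L‖ ≤ 1) :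
    ‖powerMoment l L (D - D')‖ ≤
      ‖moments n (D.mapDomain (adjoint S)) - moments n (D'.mapDomain (adjoint S'))‖ +
        2 * B * ‖S - S'‖ := by
  have norm_comp : ‖L ∘L S‖ ≤ 1 := (hS.norm_comp_le L).trans hL
  have norm_comp' : ‖L ∘L S'‖ ≤ 1 := (hS'.norm_comp_le L).trans hL
  have B_nonneg : 0 ≤ B := (norm_nonneg _).trans (hB L (by linarith))
  have change_coordinates :
      ‖powerMoment l ((L ∘L S) ∘L adjoint S') D' - powerMoment l ((L ∘L S') ∘L adjoint S') D'‖ ≤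
        2 * B * ‖S - S'‖ := by
    refine (norm_powerMoment_sub_powerMoment_le hB ((hS'.norm_comp_adjoint_le _).trans norm_comp)
      ((hS'.norm_comp_adjoint_le _).trans norm_comp')).trans ?_
    rw [← ContinuousLinearMap.sub_comp, ← ContinuousLinearMap.comp_sub]
    gcongr
    calc _ ≤ ‖L ∘L (S - S')‖ := hS'.norm_comp_adjoint_le _
      _ ≤ ‖L‖ * ‖S - S'‖ := L.opNorm_comp_le _
      _ ≤ ‖S - S'‖ := mul_le_of_le_one_left (norm_nonneg _) hL
  calc ‖powerMoment l L (D - D')‖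
      = ‖powerMoment l (L ∘L S) (D.mapDomain (adjoint S) - D'.mapDomain (adjoint S')) +
          (powerMoment l ((L ∘L S) ∘L adjoint S') D' -
            powerMoment l ((L ∘L S') ∘L adjoint S') D')‖ := by
        rw [map_sub, map_sub, powerMoment_mapDomain, powerMoment_mapDomain, hS.powerMoment_comp,
          hS'.powerMoment_comp, sub_add_sub_cancel]
    _ ≤ _ := by
        refine (norm_add_le _ _).trans (add_le_add ?_ change_coordinates)
        rw [← map_sub]
        exact norm_powerMoment_le_norm_moments _ hl norm_comp

end Captures

variable {D D' : E →₀ ℝ}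

/-- The coordinates of a signed measure `D` captured by `S`: the contraction `S`, rescaled to the
size `B` of the moments of `D`, and the moments of the coordinate vectors of the atoms. -/
def coordinates (B : ℝ) (S : EuclideanSpace ℝ (Fin n) →L[ℝ] E) (D : E →₀ ℝ) :
    (EuclideanSpace ℝ (Fin n) →L[ℝ] E) × ∀ l : Fin n, momentSpace n l :=
  ((2 * B) • S, moments n (D.mapDomain (adjoint S)))

theorem Captures.norm_coordinates_le {S : EuclideanSpace ℝ (Fin n) →L[ℝ] E} (hS : Captures S D)
    {B : ℝ} (hB : 0 ≤ B)
    (hD : ∀ l < n, ∀ L : E →L[ℝ] ℂ, ‖L‖ ≤ 1 → ‖powerMoment l L D‖ ≤ B) :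
    ‖coordinates B S D‖ ≤ 2 * B := by
  refine max_le ?_ ?_
  · rw [coordinates, norm_smul, Real.norm_of_nonneg (by positivity)]
    exact mul_le_of_le_one_right (by positivity) hS.norm_le
  · refine (norm_moments_le hB fun l hl L hL => ?_).trans (by linarith)
    rw [powerMoment_mapDomain]
    exact hD l hl _ ((hS.norm_comp_adjoint_le L).trans hL)

theorem Captures.norm_powerMoment_sub_le_two_mul_dist {S S' : EuclideanSpace ℝ (Fin n) →L[ℝ] E}
    (hS : Captures S D) (hS' : Captures S' D') {B : ℝ} (hl : l < n)
    (hB : ∀ L : E →L[ℝ] ℂ, ‖L‖ ≤ 2 → ‖powerMoment l L D'‖ ≤ B) {L : E →L[ℝ] ℂ} (hL : ‖L‖ ≤ 1) :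
    ‖powerMoment l L (D - D')‖ ≤ 2 * dist (coordinates B S D) (coordinates B S' D') := by
  have B_nonneg : 0 ≤ B := (norm_nonneg _).trans (hB L (by linarith))
  have dist_fst : dist ((2 * B) • S) ((2 * B) • S') = 2 * B * ‖S - S'‖ := by
    rw [dist_eq_norm, ← smul_sub, norm_smul, Real.norm_of_nonneg (by positivity)]
  calc _ ≤ _ := hS.norm_powerMoment_sub_le hS' hl hB hL
    _ ≤ dist (coordinates B S D) (coordinates B S' D') +
          dist (coordinates B S D) (coordinates B S' D') := by
        rw [← dist_fst, ← dist_eq_norm]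
        exact add_le_add (le_max_right _ _) (le_max_left _ _)
    _ = _ := (two_mul _).symm

theorem exists_linearIsometry_of_finrank_le {V : Type*} [NormedAddCommGroup V]
    [InnerProductSpace ℝ V] [FiniteDimensional ℝ V] (h : finrank ℝ V ≤ n) :
    Nonempty (V →ₗᵢ[ℝ] EuclideanSpace ℝ (Fin n)) := by
  let b := stdOrthonormalBasis ℝ V
  let T := b.toBasis.constr ℝ fun i => EuclideanSpace.basisFun (Fin n) ℝ (Fin.castLE h i)
  refine ⟨T.isometryOfOrthonormal (v := b.toBasis) (by simp) ?_⟩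
  have T_comp_basis : ⇑T ∘ b.toBasis = EuclideanSpace.basisFun (Fin n) ℝ ∘ Fin.castLE h :=
    funext fun i => b.toBasis.constr_basis ℝ _ i
  rw [T_comp_basis]
  exact (EuclideanSpace.basisFun (Fin n) ℝ).orthonormal.comp _ (Fin.castLE_injective h)

theorem exists_captures {D : E →₀ ℝ} (hD : D.support.card ≤ n) :
    ∃ S : EuclideanSpace ℝ (Fin n) →L[ℝ] E, Captures S D := by
  let V : Submodule ℝ E := Submodule.span ℝ D.support
  obtain ⟨T⟩ :=
    exists_linearIsometry_of_finrank_le ((finrank_span_finset_le_card D.support).trans hD)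
  have adjoint_comp_self : adjoint T.toContinuousLinearMap ∘L T.toContinuousLinearMap = 1 :=
    (ContinuousLinearMap.norm_map_iff_adjoint_comp_self _).1 T.norm_map
  refine ⟨V.subtypeL ∘L adjoint T.toContinuousLinearMap, ?_, fun x hx => ?_⟩
  · refine (ContinuousLinearMap.opNorm_comp_le _ _).trans
      (mul_le_one₀ V.norm_subtypeL_le (norm_nonneg _) ?_)
    rw [LinearIsometryEquiv.norm_map]
    exact T.norm_toContinuousLinearMap_le
  · rw [ContinuousLinearMap.adjoint_comp, ContinuousLinearMap.adjoint_adjoint,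
      Submodule.adjoint_subtypeL]
    calc V.subtypeL (adjoint T.toContinuousLinearMap
          (T.toContinuousLinearMap (V.orthogonalProjectionOnto x)))
        = V.orthogonalProjectionOnto x :=
          congrArg Subtype.val
            (DFunLike.congr_fun adjoint_comp_self (V.orthogonalProjectionOnto x))
      _ = x := Submodule.starProjection_eq_self_iff.2 (Submodule.subset_span hx)

end Coordinates

/-! ### Covering a Hellinger ball -/

section HellingerBall

open Module (finrank)

variable {E : Type*} [NormedAddCommGroup E] [InnerProductSpace ℝ E] [FiniteDimensional ℝ E]
  {R ε δ : ℝ} {k : ℕ} {a a₀ : E →₀ ℝ}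

theorem finrank_coordinates_le (n : ℕ) :
    finrank ℝ ((EuclideanSpace ℝ (Fin n) →L[ℝ] E) × ∀ l : Fin n, momentSpace n l) ≤
      n * finrank ℝ E + n ^ n := by
  have : Module.Free ℝ (∀ l : Fin n, momentSpace n l) := Module.Free.of_divisionRing _ _
  rw [Module.finrank_prod, ← LinearMap.toContinuousLinearMap.finrank_eq, Module.finrank_linearMap,
    finrank_euclideanSpace_fin]
  gcongr
  exact finrank_pi_momentSpace_le

variable [MeasurableSpace E] [BorelSpace E]

/-- The ratio between the moments of order less than `2 * k`, evaluated at functionals of norm at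
most `2`, of a difference of two `k`-atomic mixing distributions and the Hellinger distance of the
mixtures. -/
def momentConst (R : ℝ) (k : ℕ) : ℝ :=
  (2 * k).factorial * (2 * Real.exp (2 * R + 6))

theorem momentConst_pos (R : ℝ) (k : ℕ) : 0 < momentConst R k := by
  unfold momentConst; positivity

theorem IsMixing.norm_powerMoment_sub_le_momentConst_mul (ha : IsMixing R k a)
    (ha₀ : IsMixing R k a₀) (hε : hellinger (law a) (law a₀) ≤ ε) {l : ℕ} (hl : l < 2 * k)
    {L : E →L[ℝ] ℂ} (hL : ‖L‖ ≤ 2) : ‖powerMoment l L (a - a₀)‖ ≤ momentConst R k * ε := by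
  have := hellinger_nonneg (law a) (law a₀)
  calc ‖powerMoment l L (a - a₀)‖
      ≤ l.factorial * (2 * Real.exp (R * 2 + 3 * 2 ^ 2 / 2) * hellinger (law a) (law a₀)) :=
        ha.norm_powerMoment_sub_le ha₀ l hL
    _ ≤ (2 * k).factorial * (2 * Real.exp (R * 2 + 3 * 2 ^ 2 / 2) * ε) := by gcongr
    _ = momentConst R k * ε := by rw [momentConst]; ring_nf

theorem coveringNumber_hellinger_le {A : Set (Measure E)} (ha₀ : IsMixing R k a₀) (hε : 0 ≤ ε)
    (hδ : 0 < δ)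
    (hA : ∀ P ∈ A, ∃ a, IsMixing R k a ∧ P = law a ∧ hellinger P (law a₀) ≤ ε) :
    (coveringNumber δ A hellinger : ℝ≥0∞) ≤
      ENNReal.ofReal ((1 + 16 * comparisonConst R k * momentConst R k * (ε / δ)) ^
        (2 * k * finrank ℝ E + (2 * k) ^ (2 * k))) := by
  choose! a isMixing_a eq_law hellinger_le using hA
  choose! S captures using fun P (hP : P ∈ A) =>
    exists_captures ((isMixing_a P hP).card_support_sub_le ha₀)
  have comparison_pos := comparisonConst_pos R k
  have moment_pos := momentConst_pos R k
  have moment_le : ∀ P ∈ A, ∀ l < 2 * k, ∀ L : E →L[ℝ] ℂ, ‖L‖ ≤ 2 →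
      ‖powerMoment l L (a P - a₀)‖ ≤ momentConst R k * ε := fun P hP l hl L hL =>
    (isMixing_a P hP).norm_powerMoment_sub_le_momentConst_mul ha₀
      (eq_law P hP ▸ hellinger_le P hP) hl hL
  let Φ : Measure E → _ := fun P => coordinates (momentConst R k * ε) (S P) (a P - a₀)
  have norm_Φ_le : ∀ P ∈ A, ‖Φ P‖ ≤ 2 * (momentConst R k * ε) := fun P hP =>
    (captures P hP).norm_coordinates_le (by positivity) fun l hl L hL =>
      moment_le P hP l hl L (hL.trans one_le_two)
  have hellinger_le_dist : ∀ P ∈ A, ∀ Q ∈ A,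
      hellinger P Q ≤ 2 * comparisonConst R k * dist (Φ P) (Φ Q) := fun P hP Q hQ => by
    refine (congrArg₂ hellinger (eq_law P hP) (eq_law Q hQ)).trans_le ?_
    refine ((isMixing_a P hP).hellinger_law_le (isMixing_a Q hQ)
      (M := 2 * dist (Φ P) (Φ Q)) (by positivity) fun l hl L hL => ?_).trans_eq (by ring)
    rw [← sub_sub_sub_cancel_right (a P) (a Q) a₀]
    exact (captures P hP).norm_powerMoment_sub_le_two_mul_dist (captures Q hQ) hl
      (moment_le Q hQ l hl) hL
  refine (coveringNumber_le_of_le_mul_dist (by positivity) (by positivity) hδ norm_Φ_le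
    hellinger_le_dist).trans (ENNReal.ofReal_le_ofReal ?_)
  have ratio_eq : 1 + 4 * (2 * comparisonConst R k) * (2 * (momentConst R k * ε)) / δ =
      1 + 16 * comparisonConst R k * momentConst R k * (ε / δ) := by ring
  rw [ratio_eq]
  exact pow_le_pow_right₀ (le_add_of_nonneg_right (by positivity)) (finrank_coordinates_le _)

theorem exists_isMixing_mixture_eq_law {d : ℕ} {Γ : Measure (EuclideanSpace ℝ (Fin d))}
    (hΓ : Γ ∈ mixingDistributions R k d) : ∃ a, IsMixing R k a ∧ mixture Γ = law a := by
  obtain ⟨w, μ, hw, hμ, rfl⟩ := hΓ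
  exact ⟨_, isMixing_sum_single hw hμ, mixture_sum_smul_dirac w μ⟩

theorem coveringNumber_hellingerBall_le {d : ℕ} {Γ₀ : Measure (EuclideanSpace ℝ (Fin d))}
    (hΓ₀ : Γ₀ ∈ mixingDistributions R k d) (hε : 0 ≤ ε) (hδ : 0 < δ) :
    (coveringNumber δ (hellingerBall R k d ε Γ₀) hellinger : ℝ≥0∞) ≤
      ENNReal.ofReal ((1 + 16 * comparisonConst R k * momentConst R k * (ε / δ)) ^
        (2 * k * d + (2 * k) ^ (2 * k))) := by
  obtain ⟨a₀, isMixing_a₀, mixture_eq⟩ := exists_isMixing_mixture_eq_law hΓ₀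
  have covering_le := coveringNumber_hellinger_le isMixing_a₀ hε hδ
    (A := hellingerBall R k d ε Γ₀) fun P ⟨Γ, hΓ, hP, hPε⟩ =>
      let ⟨a, isMixing_a, ha⟩ := exists_isMixing_mixture_eq_law hΓ
      ⟨a, isMixing_a, hP.trans ha, mixture_eq ▸ hP ▸ hPε⟩
  rwa [finrank_euclideanSpace_fin] at covering_le

end HellingerBall

/-! ### The entropy exponent -/

section Exponent

variable {R : ℝ} {k : ℕ}

/-- A constant `κ` such that the ratio between Hellinger distances and coordinate distances on
`k`-atomic mixtures with atoms in the ball of radius `R` is at most `exp (κ * k ^ 2)`. -/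
def distortionExponent (R : ℝ) : ℝ :=
  17 + 2 * R + R ^ 2 / 4 + 2 * (1 + 3 * R) ^ 2

theorem distortionExponent_pos (R : ℝ) : 0 < distortionExponent R := by
  unfold distortionExponent
  nlinarith [sq_nonneg (R / 2 + 2), sq_nonneg (1 + 3 * R)]

theorem factorial_two_mul_le_exp (k : ℕ) :
    ((2 * k).factorial : ℝ) ≤ Real.exp (4 * (k : ℝ) ^ 2) := calc
  ((2 * k).factorial : ℝ) ≤ (2 * k : ℕ) ^ (2 * k) := mod_cast Nat.factorial_le_pow (2 * k)
  _ ≤ Real.exp (2 * k : ℕ) ^ (2 * k) := by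
    gcongr
    linarith [Real.add_one_le_exp ((2 * k : ℕ) : ℝ)]
  _ = Real.exp (4 * (k : ℝ) ^ 2) := by
    rw [← Real.exp_nat_mul]
    push_cast
    ring_nf

theorem comparisonConst_mul_momentConst_le_exp (hk : 1 ≤ k) :
    16 * comparisonConst R k * momentConst R k ≤
      Real.exp (distortionExponent R * (k : ℝ) ^ 2) := by
  have hk' : (1 : ℝ) ≤ k := mod_cast hk
  have k_le_sq : (k : ℝ) ≤ (k : ℝ) ^ 2 := le_self_pow₀ hk' two_ne_zero
  have two_le_exp : 2 ≤ Real.exp 1 := by linarith [Real.add_one_le_exp (1 : ℝ)]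
  calc 16 * comparisonConst R k * momentConst R k
      = 2 ^ 5 * Real.exp (R ^ 2 / 4) * (2 * Real.exp ((1 + 3 * R) ^ 2)) ^ (2 * k) *
          (2 * k).factorial * Real.exp (2 * R + 6) := by
        rw [comparisonConst, momentConst]
        ring
    _ ≤ Real.exp 1 ^ 5 * Real.exp (R ^ 2 / 4) *
          (Real.exp 1 * Real.exp ((1 + 3 * R) ^ 2)) ^ (2 * k) * Real.exp (4 * (k : ℝ) ^ 2) *
          Real.exp (2 * R + 6) := by
        gcongr
        exact factorial_two_mul_le_exp k
    _ = Real.exp (11 + 2 * R + R ^ 2 / 4 + 2 * (1 + (1 + 3 * R) ^ 2) * k + 4 * (k : ℝ) ^ 2) := by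
        simp only [← Real.exp_add, ← Real.exp_nat_mul]
        push_cast
        ring_nf
    _ ≤ Real.exp (distortionExponent R * (k : ℝ) ^ 2) := by
        gcongr
        rw [distortionExponent]
        nlinarith [mul_le_mul_of_nonneg_left (hk'.trans k_le_sq)
          (by nlinarith [sq_nonneg (R / 2 + 2)] : 0 ≤ 11 + 2 * R + R ^ 2 / 4),
          mul_le_mul_of_nonneg_left k_le_sq (sq_nonneg (1 + 3 * R))]

theorem one_add_mul_le_rpow {A t x : ℝ} (ht : 0 ≤ t) (hx : 2 ≤ x) (hA : A ≤ Real.exp t) :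
    1 + A * x ≤ x ^ (2 + 2 * t) := by
  have x_pos : 0 < x := by linarith
  have exp_le : Real.exp t ≤ x ^ (2 * t) := by
    rw [Real.rpow_def_of_pos x_pos]
    gcongr
    nlinarith [Real.log_le_log two_pos hx, Real.log_two_gt_d9]
  have one_le := Real.one_le_exp ht
  calc 1 + A * x ≤ 2 * x * Real.exp t := by nlinarith
    _ ≤ x ^ (2 : ℝ) * x ^ (2 * t) := by
        rw [Real.rpow_two, sq]
        gcongr
    _ = x ^ (2 + 2 * t) := (Real.rpow_add x_pos _ _).symm

theorem sq_mul_add_pow_le (hk : 1 ≤ k) (d : ℕ) :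
    (k : ℝ) ^ 2 * ((2 * k * d + (2 * k) ^ (2 * k) : ℕ) : ℝ) ≤
      2 * ((d : ℝ) * (k : ℝ) ^ 4 + (2 * (k : ℝ)) ^ (2 * k + 2)) := by
  have pow_le_pow : (k : ℝ) ^ 3 ≤ (k : ℝ) ^ 4 :=
    pow_le_pow_right₀ (mod_cast hk) (by norm_num)
  have pow_nonneg : 0 ≤ (2 * (k : ℝ)) ^ (2 * k) * (k : ℝ) ^ 2 := by positivity
  rw [pow_add (2 * (k : ℝ))]
  push_cast
  nlinarith [mul_le_mul_of_nonneg_left pow_le_pow (Nat.cast_nonneg (α := ℝ) d)]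

theorem covering_bound_le_rpow {x : ℝ} (hk : 1 ≤ k) (hx : 2 ≤ x) (d : ℕ) :
    (1 + 16 * comparisonConst R k * momentConst R k * x) ^ (2 * k * d + (2 * k) ^ (2 * k)) ≤
      x ^ (4 * (1 + distortionExponent R) *
        ((d : ℝ) * (k : ℝ) ^ 4 + (2 * (k : ℝ)) ^ (2 * k + 2))) := by
  have x_pos : 0 < x := by linarith
  have one_le_sq : (1 : ℝ) ≤ (k : ℝ) ^ 2 := one_le_pow₀ (mod_cast hk)
  have comparison_pos := comparisonConst_pos R k
  have moment_pos := momentConst_pos R k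
  have distortion_pos := distortionExponent_pos R
  set N := 2 * k * d + (2 * k) ^ (2 * k)
  calc (1 + 16 * comparisonConst R k * momentConst R k * x) ^ N
      ≤ (x ^ (2 + 2 * (distortionExponent R * (k : ℝ) ^ 2))) ^ N := by
        gcongr
        exact one_add_mul_le_rpow (by positivity) hx (comparisonConst_mul_momentConst_le_exp hk)
    _ = x ^ ((2 + 2 * (distortionExponent R * (k : ℝ) ^ 2)) * (N : ℝ)) := by
        rw [← Real.rpow_natCast, ← Real.rpow_mul x_pos.le]
    _ ≤ x ^ (2 * (1 + distortionExponent R) * ((k : ℝ) ^ 2 * N)) := by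
        refine Real.rpow_le_rpow_of_exponent_le (by linarith) ?_
        nlinarith [mul_le_mul_of_nonneg_right one_le_sq (Nat.cast_nonneg (α := ℝ) N)]
    _ ≤ _ := by
        refine Real.rpow_le_rpow_of_exponent_le (by linarith) ?_
        linarith [mul_le_mul_of_nonneg_left (sq_mul_add_pow_le hk d)
          (by positivity : 0 ≤ 2 * (1 + distortionExponent R))]

end Exponent

end GaussianMixture

end

theorem mainTheorem4 (R : ℝ) :
    ∃ c : ℝ, 0 < c ∧
      ∀ (k d : ℕ) (Γ₀ : Measure (EuclideanSpace ℝ (Fin d))),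
        Γ₀ ∈ GaussianMixture.mixingDistributions R k d →
        ∀ ε δ : ℝ, 0 < δ → δ ≤ ε / 2 →
          ((GaussianMixture.coveringNumber δ (GaussianMixture.hellingerBall R k d ε Γ₀)
              GaussianMixture.hellinger : ℕ∞) : ℝ≥0∞) ≤
            ENNReal.ofReal
              ((ε / δ) ^ (c * ((d : ℝ) * (k : ℝ) ^ 4 + (2 * (k : ℝ)) ^ (2 * k + 2)))) := by
  open GaussianMixture in
  have distortion_pos := distortionExponent_pos R
  refine ⟨4 * (1 + distortionExponent R), by positivity, fun k d Γ₀ hΓ₀ ε δ hδ hδε => ?_⟩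
  obtain ⟨a₀, isMixing_a₀, -⟩ := exists_isMixing_mixture_eq_law hΓ₀
  have one_le_k : 1 ≤ k :=
    (Finset.card_pos.2 isMixing_a₀.support_nonempty).trans_le isMixing_a₀.card_support_le
  have two_le_ratio : 2 ≤ ε / δ := (le_div_iff₀ hδ).2 (by linarith)
  exact (coveringNumber_hellingerBall_le hΓ₀ (by linarith) hδ).trans
    (ENNReal.ofReal_le_ofReal (covering_bound_le_rpow one_le_k two_le_ratio d))
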